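/- **Theorem (consistency of the $P^2$ semi-Lagrangian discontinuous Galerkin scheme).** Let $\Omega\subset\mathbb R^2$ be a bounded open set, $T\in\mathbb R$, and let $u,a,b$ be $C^\infty$ on a neighbourhood of $\overline\Omega\times[0,T]$ with $$u_t+(a\,u)_x+(b\,u)_y=0\qquad\text{on }\Omega\times[0,T].$$ Let $\sigma,c_1>0$ and $c_2,\kappa,C_0\in\mathbb R$. Then there are constants $C,h_0>0$, depending only on these data, such that the following holds. *Mesh.* Let $K_1,\dots,K_J\subset\overline\Omega$ be nondegenerate closed triangles with pairwise disjoint interiors (for example a triangulation of $\overline\Omega$), and put $h=\max_j\operatorname{diam}K_j\le h_0$. Assume that every $K_j$ contains a disc of radius $\sigma h$. Let $V_h^2$ be the space of functions whose restriction to each $K_j$ lies in $P^2(K_j)$, the polynomials of total degree at most $2$. Let $t^n\ge 0$, $t^{n+1}=t^n+\Delta t\le T$ and $c_1h\le\Delta t\le c_2h$. *Tracing.* For each $j$ let $v_1,v_2,v_3$ be the vertices of $K_j$, $v_4,v_5,v_6$ the midpoints of the edges $v_1v_2$, $v_2v_3$, $v_1v_3$, and $v_7$ the barycenter. Let $v_q^\star=\Phi(v_q)$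 be obtained from a map $\Phi$ that approximates the backward characteristics: whenever $(x(t),y(t))$ solves $x'=a(x,y,t)$, $y'=b(x,y,t)$ on $[t^n,t^{n+1}]$, stays in $\overline\Omega$ and equals $v_q$ at time $t^{n+1}$, then $|v_q^\star-(x(t^n),y(t^n))|\le\kappa\,\Delta t^3$ (exact tracing and Runge–Kutta tracing of order at least two are included). *Upstream element and test functions.* Let $K_j^\star$ be the quadratic-curvilinear triangle $\{\sum_{i=1}^6N_i(\xi,\eta)\,v_i^\star:\ \xi,\eta\ge0,\ \xi+\eta\le1\}$, where $N_1=1-3\xi-3\eta+2\xi^2+4\xi\eta+2\eta^2$, $N_2=2\xi^2-\xi$, $N_3=2\eta^2-\eta$, $N_4=4\xi-4\xi\eta-4\xi^2$, $N_5=4\xi\eta$, $N_6=4\eta-4\xi\eta-4\eta^2$. For $\Psi\in P^2$ let $\psi^\star\in P^2$ be a least-squares fit, i.e. a minimizer of $\sum_{q=1}^7\bigl(\psi^\star(v_q^\star)-\Psi(v_q)\bigr)^2$ over $P^2$. *Claim.* Let $u^n\in V_h^2$ be a third-order approximation of the exact solution at $t^n$, in the sense that $\|u^n-u(\cdot,t^n)\|_{L^2(K_l)}\le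 C_0h^3$ for all $l$. Then there is $u^{n+1}\in V_h^2$ such that, for every $j$ for which all points of $K_j$ at time $t^{n+1}$ are reached by characteristics that stay in $\overline\Omega$ on $[t^n,t^{n+1}]$ and for which $K_j^\star\subset\bigcup_lK_l$ (so that no boundary data enter), $u^{n+1}|_{K_j}$ is the unique element of $P^2(K_j)$ with $$\int_{K_j}u^{n+1}\,\Psi\,dx\,dy=\int_{K_j^\star}u^n\,\psi^\star\,dx\,dy=\sum_{l}\int_{K_j^\star\cap K_l}u^n\,\psi^\star\,dx\,dy$$ for all $\Psi\in P^2(K_j)$ and all least-squares fits $\psi^\star$ belonging to $\Psi$, and $$\|u^{n+1}-u(\cdot,t^{n+1})\|_{L^2(K_j)}\le C\,h^3 .$$ -/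

import Mathlib

open MeasureTheory Set
open scoped ContDiff

noncomputable section

namespace SLDG

/-- The plane with its Euclidean norm and Lebesgue measure. -/
abbrev Plane := EuclideanSpace ℝ (Fin 2)

/-! ### The transport equation and its characteristics -/

/-- `f` is `C^∞` up to the boundary of the cylinder `closure Ω × [0, T]`: it is smooth on some open
neighbourhood of that cylinder. -/
def SmoothOnCylinder (Ω : Set Plane) (T : ℝ) (f : Plane × ℝ → ℝ) : Prop :=
  ∃ U : Set (Plane × ℝ), IsOpen U ∧ closure Ω ×ˢ Icc 0 T ⊆ U ∧ ContDiffOn ℝ ∞ f U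

/-- The equation `u_t + (a u)_x + (b u)_y = 0` on `Ω × [0, T]`. -/
def SolvesTransport (Ω : Set Plane) (T : ℝ) (a b u : Plane × ℝ → ℝ) : Prop :=
  ∀ x ∈ Ω, ∀ t ∈ Icc 0 T,
    deriv (fun s => u (x, s)) t
      + lineDeriv ℝ (fun y => a (y, t) * u (y, t)) x (EuclideanSpace.single 0 1)
      + lineDeriv ℝ (fun y => b (y, t) * u (y, t)) x (EuclideanSpace.single 1 1) = 0

/-- `γ` is a characteristic curve on the time interval `[s, t]` that stays in `closure Ω`. -/
def IsCharacteristic (Ω : Set Plane) (a b : Plane × ℝ → ℝ) (s t : ℝ) (γ : ℝ → Plane) : Prop :=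
  ∀ τ ∈ Icc s t, γ τ ∈ closure Ω ∧
    HasDerivWithinAt γ !₂[a (γ τ, τ), b (γ τ, τ)] (Icc s t) τ

/-- `y` is the exact foot at time `s` of the characteristic in `closure Ω` that arrives at `x` at
time `t`. -/
def IsFoot (Ω : Set Plane) (a b : Plane × ℝ → ℝ) (s t : ℝ) (x y : Plane) : Prop :=
  ∃ γ : ℝ → Plane, IsCharacteristic Ω a b s t γ ∧ γ t = x ∧ γ s = y

/-! ### Triangular meshes and discontinuous piecewise polynomials -/

/-- The closed triangle with the three given vertices. -/
def triangle (v : Fin 3 → Plane) : Set Plane := convexHull ℝ (range v)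

/-- Finitely many nondegenerate closed triangles with pairwise disjoint interiors (conforming
triangulations are a special case). -/
structure TriMesh (J : ℕ) where
  vert : Fin J → Fin 3 → Plane
  nondegenerate : ∀ j, AffineIndependent ℝ (vert j)
  nonoverlapping : Pairwise fun i j =>
    Disjoint (interior (triangle (vert i))) (interior (triangle (vert j)))

/-- Polynomials in two variables of total degree at most `k`. -/
abbrev Poly (k : ℕ) : Type := MvPolynomial.restrictTotalDegree (Fin 2) ℝ k

/-- The value of a polynomial at a point of the plane. -/
def pval {k : ℕ} (p : Poly k) (x : Plane) : ℝ :=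
  MvPolynomial.eval (fun i => x i) (p : MvPolynomial (Fin 2) ℝ)

namespace TriMesh

variable {J : ℕ} (M : TriMesh J)

/-- The element `K_j`. -/
def cell (j : Fin J) : Set Plane := triangle (M.vert j)

/-- The region covered by the mesh. -/
def region : Set Plane := ⋃ j, M.cell j

/-- The mesh size `h = max_j diam K_j`. -/
def size : ℝ := ⨆ j, Metric.diam (M.cell j)

/-- Shape regularity and quasi-uniformity with constant `σ`: every element contains a disc of
radius `σ h` (and has diameter at most `h` by the definition of `h`). -/
def IsQuasiUniform (σ : ℝ) : Prop :=
  ∀ j, ∃ c : Plane, Metric.closedBall c (σ * M.size) ⊆ M.cell j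

/-- The space `V_h^k`: one polynomial of degree at most `k` for each element. -/
abbrev DGSpace (_M : TriMesh J) (k : ℕ) := Fin J → Poly k

/-- The seven points of `K_j` that are traced back: three vertices, three edge midpoints (in the
order of the TRIA6 element) and the barycenter. -/
def node (j : Fin J) : Fin 7 → Plane :=
  ![M.vert j 0, M.vert j 1, M.vert j 2,
    midpoint ℝ (M.vert j 0) (M.vert j 1),
    midpoint ℝ (M.vert j 1) (M.vert j 2),
    midpoint ℝ (M.vert j 0) (M.vert j 2),
    (1 / 3 : ℝ) • (M.vert j 0 + M.vert j 1 + M.vert j 2)]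

end TriMesh

/-! ### The quadratic isoparametric element TRIA6 -/

/-- The closed reference triangle. -/
def refTriangle : Set (ℝ × ℝ) := {ξ | 0 ≤ ξ.1 ∧ 0 ≤ ξ.2 ∧ ξ.1 + ξ.2 ≤ 1}

/-- The six quadratic shape functions. -/
def shape (ξ η : ℝ) : Fin 6 → ℝ :=
  ![-3 * ξ + 2 * ξ ^ 2 - 3 * η + 2 * η ^ 2 + 4 * ξ * η + 1,
    -ξ + 2 * ξ ^ 2,
    -η + 2 * η ^ 2,
    4 * ξ - 4 * ξ * η - 4 * ξ ^ 2,
    4 * ξ * η,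
    4 * η - 4 * ξ * η - 4 * η ^ 2]

/-- The isoparametric map with control points `w`. -/
def isoMap (w : Fin 6 → Plane) (ξ : ℝ × ℝ) : Plane := ∑ i, shape ξ.1 ξ.2 i • w i

/-! ### One step of the scheme -/

section Scheme

variable {J : ℕ} (M : TriMesh J)

/-- The upstream element `K_j^⋆`: the quadratic-curvilinear triangle through the traced nodes
`Φ (v_1), …, Φ (v_6)`, where `Φ` is the (numerical) backward tracing of points. -/
def upstream (Φ : Plane → Plane) (j : Fin J) : Set Plane :=
  isoMap (fun i : Fin 6 => Φ (M.node j i.castSucc)) '' refTriangle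

/-- `ψ` is a least-squares fit in `P^2` at the seven traced points to the values of `Ψ` at the
original points. -/
def IsLeastSquaresFit (Φ : Plane → Plane) (j : Fin J) (Ψ ψ : Poly 2) : Prop :=
  ∀ χ : Poly 2,
    ∑ q, (pval ψ (Φ (M.node j q)) - pval Ψ (M.node j q)) ^ 2
      ≤ ∑ q, (pval χ (Φ (M.node j q)) - pval Ψ (M.node j q)) ^ 2

/-- The integral of `v ψ` over `S ∩ region`, `v ∈ V_h^2`, as the sum over the overlaps of `S` with
the elements of the background mesh. -/
def remapIntegral (S : Set Plane) (v : M.DGSpace 2) (ψ : Poly 2) : ℝ :=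
  ∑ l, ∫ x in S ∩ M.cell l, pval (v l) x * pval ψ x

/-- The polynomial `p` is the restriction to `K_j` of the result of one step of the `P^2` scheme
from `uOld`: `∫_{K_j} p Ψ = ∫_{K_j^⋆} uOld ψ^⋆` for all `Ψ ∈ P^2`, with `ψ^⋆` the least-squares
reconstruction that belongs to `Ψ`. -/
def IsUpdate (Φ : Plane → Plane) (uOld : M.DGSpace 2) (j : Fin J) (p : Poly 2) : Prop :=
  ∀ Ψ ψ : Poly 2, IsLeastSquaresFit M Φ j Ψ ψ →
    ∫ x in M.cell j, pval p x * pval Ψ x = remapIntegral M (upstream M Φ j) uOld ψ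

/-- The tracing `Φ` from time `t` back to time `s` has error at most `κ (t - s)^3` at the points
that are traced (exact tracing, and every one-step method of order at least two). -/
def TracingAccurate (Ω : Set Plane) (a b : Plane × ℝ → ℝ) (s t κ : ℝ) (Φ : Plane → Plane) : Prop :=
  ∀ j q y, IsFoot Ω a b s t (M.node j q) y → dist (Φ (M.node j q)) y ≤ κ * (t - s) ^ 3

/-- The upstream data of `K_j` lie in the domain, so that no boundary data enter: all
characteristics that end in `K_j` run in `closure Ω`, and `K_j^⋆` is covered by the mesh. -/
def UpstreamInside (Ω : Set Plane) (a b : Plane × ℝ → ℝ) (s t : ℝ) (Φ : Plane → Plane)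
    (j : Fin J) : Prop :=
  (∀ x ∈ M.cell j, ∃ y, IsFoot Ω a b s t x y) ∧ upstream M Φ j ⊆ M.region

/-- The `L^2(K_j)` norm of `p - f`. -/
def cellError (j : Fin J) (p : Poly 2) (f : Plane → ℝ) : ENNReal :=
  eLpNorm (fun x => pval p x - f x) 2 (volume.restrict (M.cell j))

end Scheme

end SLDG

end

noncomputable section

namespace SLDG

/-! ### Quadratic functions on the plane -/

/-! The L² norm over one cell already carries a factor h, the square root of its area. It therefore
suffices to show that the new polynomial differs from the exact solution by O(h²) pointwise on the
cell, and so every expansion can stop at relative order h².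

Write K_j as x₀ + L(reference triangle), with L of size h and inverse of size 1/h, and put Δ =
t^{n+1} - t^n, A = (a, b). Taylor expansion in time and space (`foot_expansion`) shows that the foot
of the characteristic through x is w + E(x - x₀) + O(h³), where E = I - Δ DA and w is a point
independent of x. Undoing E L costs a factor 1/h, so the traced nodes are the images under the
affine map w + E L of reference nodes displaced by ρ = O(h²) (`exists_traced`). In reference
coordinates the upstream element is thus an O(h²) perturbation of the reference triangle. The seven
displaced nodes still determine quadratics, and the least-squares fit, read through w + E L, differs
from Ψ, read through x₀ + L, by O(h²) (`nodalNorm_fit_sub_le`, `Traced.fit_estimate`).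

Pull both the upstream integral and the target integral of uΨ back to the reference triangle and
divide by |det L|. The first integrand is a product of four factors: u at the foot, u - Δ(u_t +
A·∇u) + O(h²); the Jacobian of E, 1 - Δ div A + O(h²); the Jacobian of the perturbation, 1 + O(h²);
and the fit, Ψ + O(h²). The terms linear in Δ cancel because u_t + A·∇u + u div A = 0, which leaves
uΨ + O(h²) (`product_estimate`, `exists_consistency`).

The old error enters through Cauchy–Schwarz: each overlap contributes h³ · h, and only boundedly
many cells are met (`exists_remap_bound`). Since |det L| is at least a constant times h², this too
is of relative order h². Finally, testing with the difference of the update and the linear Taylor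
polynomial of u, together with coercivity of the mass form on the reference triangle
(`exists_coercivity`), converts the moment bound into the pointwise bound
(`exists_pointwise_bound`). -/

/-- `f` is a polynomial function of degree at most two. -/
def IsQuad (f : Plane → ℝ) : Prop :=
  ∃ c : Fin 6 → ℝ, ∀ x, f x = c 0 + c 1 * x 0 + c 2 * x 1 + c 3 * x 0 ^ 2 + c 4 * (x 0 * x 1)
    + c 5 * x 1 ^ 2

lemma IsQuad.add {f g : Plane → ℝ} (hf : IsQuad f) (hg : IsQuad g) :
    IsQuad (fun x => f x + g x) := by
  obtain ⟨c, hc⟩ := hf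
  obtain ⟨d, hd⟩ := hg
  exact ⟨fun i => c i + d i, fun x => by simp only [hc, hd]; ring⟩

lemma IsQuad.const_mul {f : Plane → ℝ} (hf : IsQuad f) (r : ℝ) : IsQuad (fun x => r * f x) := by
  obtain ⟨c, hc⟩ := hf
  exact ⟨fun i => r * c i, fun x => by simp only [hc]; ring⟩

lemma IsQuad.sub {f g : Plane → ℝ} (hf : IsQuad f) (hg : IsQuad g) :
    IsQuad (fun x => f x - g x) := by
  obtain ⟨c, hc⟩ := hf
  obtain ⟨d, hd⟩ := hg
  exact ⟨fun i => c i - d i, fun x => by simp only [hc, hd]; ring⟩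

lemma IsQuad.sum {ι : Type*} (s : Finset ι) {f : ι → Plane → ℝ} (hf : ∀ i ∈ s, IsQuad (f i)) :
    IsQuad (fun x => ∑ i ∈ s, f i x) := by
  classical
  induction s using Finset.induction_on with
  | empty => exact ⟨0, fun x => by simp⟩
  | insert a s ha ih =>
    simp only [Finset.sum_insert ha]
    exact (hf a (by simp)).add (ih fun i hi => hf i (by simp [hi]))

lemma IsQuad.continuous {f : Plane → ℝ} (hf : IsQuad f) : Continuous f := by
  obtain ⟨c, hc⟩ := hf
  rw [show f = _ from funext hc]
  fun_prop

lemma plane_eq_sum (x : Plane) :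
    x = x 0 • EuclideanSpace.single 0 1 + x 1 • EuclideanSpace.single 1 1 := by
  ext i
  fin_cases i <;> simp

/-- Affine invariance of P² lets all estimates on cells and on upstream elements be carried out on
one fixed reference triangle, with constants independent of the mesh. -/
lemma IsQuad.comp_affine {f : Plane → ℝ} (hf : IsQuad f) (w : Plane) (H : Plane →L[ℝ] Plane) :
    IsQuad (fun x => f (w + H x)) := by
  obtain ⟨c, hc⟩ := hf
  set α := H (EuclideanSpace.single 0 1)
  set β := H (EuclideanSpace.single 1 1)
  have hH : ∀ x, H x = x 0 • α + x 1 • β := fun x => by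
    conv_lhs => rw [plane_eq_sum x, map_add, map_smul, map_smul]
  refine ⟨![c 0 + c 1 * w 0 + c 2 * w 1 + c 3 * w 0 ^ 2 + c 4 * (w 0 * w 1) + c 5 * w 1 ^ 2,
    c 1 * α 0 + c 2 * α 1 + 2 * c 3 * w 0 * α 0 + c 4 * (w 0 * α 1 + w 1 * α 0)
      + 2 * c 5 * w 1 * α 1,
    c 1 * β 0 + c 2 * β 1 + 2 * c 3 * w 0 * β 0 + c 4 * (w 0 * β 1 + w 1 * β 0)
      + 2 * c 5 * w 1 * β 1,
    c 3 * α 0 ^ 2 + c 4 * α 0 * α 1 + c 5 * α 1 ^ 2,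
    2 * c 3 * α 0 * β 0 + c 4 * (α 0 * β 1 + α 1 * β 0) + 2 * c 5 * α 1 * β 1,
    c 3 * β 0 ^ 2 + c 4 * β 0 * β 1 + c 5 * β 1 ^ 2], fun x => ?_⟩
  simp [hc, hH]
  ring

lemma isQuad_pval (p : Poly 2) : IsQuad (pval p) := by
  obtain ⟨p, hp⟩ := p
  rw [MvPolynomial.mem_restrictTotalDegree] at hp
  have : pval (⟨p, (MvPolynomial.mem_restrictTotalDegree _ _ _).2 hp⟩ : Poly 2) =
      fun x : Plane => ∑ d ∈ p.support, MvPolynomial.coeff d p * (x 0 ^ d 0 * x 1 ^ d 1) := by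
    funext x
    simp [pval, MvPolynomial.eval_eq']
  rw [this]
  refine IsQuad.sum _ fun d hd => IsQuad.const_mul ?_ _
  have h2 : d 0 + d 1 ≤ 2 := by
    have := (MvPolynomial.le_totalDegree hd).trans hp
    rwa [Finsupp.sum_fintype _ _ (by simp), Fin.sum_univ_two] at this
  obtain ⟨m, hm⟩ : ∃ m, d 0 = m := ⟨_, rfl⟩
  obtain ⟨n, hn⟩ : ∃ n, d 1 = n := ⟨_, rfl⟩
  simp only [hm, hn] at h2 ⊢
  have hm2 : m ≤ 2 := by omega
  have hn2 : n ≤ 2 := by omega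
  -- Six exponent pairs survive, in the order (0,0), (0,1), (0,2), (1,0), (1,1), (2,0).
  interval_cases m <;> interval_cases n <;> first | omega | skip
  · exact ⟨![1, 0, 0, 0, 0, 0], fun x => by simp⟩
  · exact ⟨![0, 0, 1, 0, 0, 0], fun x => by simp⟩
  · exact ⟨![0, 0, 0, 0, 0, 1], fun x => by simp⟩
  · exact ⟨![0, 1, 0, 0, 0, 0], fun x => by simp⟩
  · exact ⟨![0, 0, 0, 0, 1, 0], fun x => by simp⟩
  · exact ⟨![0, 0, 0, 1, 0, 0], fun x => by simp⟩

lemma IsQuad.exists_pval_eq {f : Plane → ℝ} (hf : IsQuad f) : ∃ p : Poly 2, pval p = f := by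
  obtain ⟨c, hc⟩ := hf
  have hX : ∀ i j : Fin 2, (MvPolynomial.X i * MvPolynomial.X j : MvPolynomial (Fin 2) ℝ) ∈
      MvPolynomial.restrictTotalDegree (Fin 2) ℝ 2 := fun i j => by
    rw [MvPolynomial.mem_restrictTotalDegree]
    refine (MvPolynomial.totalDegree_mul _ _).trans ?_
    simp
  have hX1 : ∀ i : Fin 2, (MvPolynomial.X i : MvPolynomial (Fin 2) ℝ) ∈
      MvPolynomial.restrictTotalDegree (Fin 2) ℝ 2 := fun i => by
    rw [MvPolynomial.mem_restrictTotalDegree]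
    simp
  have h1 : (1 : MvPolynomial (Fin 2) ℝ) ∈ MvPolynomial.restrictTotalDegree (Fin 2) ℝ 2 := by
    rw [MvPolynomial.mem_restrictTotalDegree]
    simp
  refine ⟨c 0 • ⟨1, h1⟩ + c 1 • ⟨_, hX1 0⟩ + c 2 • ⟨_, hX1 1⟩ + c 3 • ⟨_, hX 0 0⟩
    + c 4 • ⟨_, hX 0 1⟩ + c 5 • ⟨_, hX 1 1⟩, funext fun x => ?_⟩
  simp [pval, hc, MvPolynomial.smul_eval]
  ring

lemma pval_injective {p q : Poly 2} (h : ∀ x, pval p x = pval q x) : p = q := by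
  refine Subtype.ext (MvPolynomial.funext fun x => ?_)
  simpa [pval] using h (WithLp.toLp 2 x)

@[simp] lemma pval_add (p q : Poly 2) (x : Plane) : pval (p + q) x = pval p x + pval q x := by
  simp [pval]

@[simp] lemma pval_sub (p q : Poly 2) (x : Plane) : pval (p - q) x = pval p x - pval q x := by
  simp [pval]

@[simp] lemma pval_smul (r : ℝ) (p : Poly 2) (x : Plane) : pval (r • p) x = r * pval p x := by
  simp [pval, MvPolynomial.smul_eval]

@[simp] lemma pval_zero (x : Plane) : pval (0 : Poly 2) x = 0 := by
  simp [pval]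

lemma continuous_pval (p : Poly 2) : Continuous (pval p) := (isQuad_pval p).continuous

/-- Finite dimension is what makes the definite forms of the scheme (the Gram form of the fit and
the mass form) invertible. -/
instance finite_poly : Module.Finite ℝ (Poly 2) := by
  let F : (Fin 6 → ℝ) →ₗ[ℝ] (Plane → ℝ) :=
    { toFun := fun c x => c 0 + c 1 * x 0 + c 2 * x 1 + c 3 * x 0 ^ 2 + c 4 * (x 0 * x 1)
        + c 5 * x 1 ^ 2
      map_add' := fun c d => by funext x; simp; ring
      map_smul' := fun r c => by funext x; simp; ring }
  let G : Poly 2 →ₗ[ℝ] LinearMap.range F :=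
    { toFun := fun p => ⟨pval p, by
        obtain ⟨c, hc⟩ := isQuad_pval p
        exact ⟨c, funext fun x => (hc x).symm⟩⟩
      map_add' := fun p q => Subtype.ext (funext fun x => by simp)
      map_smul' := fun r q => Subtype.ext (funext fun x => by simp) }
  refine Module.Finite.of_injective G fun p q hpq => pval_injective fun x => ?_
  exact congrFun (congrArg Subtype.val hpq) x

/-! ### The reference triangle and its shape functions -/

/-- The reference triangle as a subset of the plane. -/
def refTri : Set Plane := {ξ | 0 ≤ ξ 0 ∧ 0 ≤ ξ 1 ∧ ξ 0 + ξ 1 ≤ 1}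

/-- The seven nodes of the reference triangle. -/
def refNode : Fin 7 → Plane :=
  ![!₂[0, 0], !₂[1, 0], !₂[0, 1], !₂[1 / 2, 0], !₂[1 / 2, 1 / 2], !₂[0, 1 / 2], !₂[1 / 3, 1 / 3]]

/-- The shape functions on the plane. -/
def shapeFun (i : Fin 6) (ξ : Plane) : ℝ := shape (ξ 0) (ξ 1) i

/-- The six vertices and edge midpoints are unisolvent for P². The identity holds on the whole
plane, so nodal values also control f outside the reference triangle, where perturbed points may
lie. -/
lemma IsQuad.eq_sum_shapeFun {f : Plane → ℝ} (hf : IsQuad f) (ξ : Plane) :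
    f ξ = ∑ i, shapeFun i ξ * f (refNode i.castSucc) := by
  obtain ⟨c, hc⟩ := hf
  simp [hc, Fin.sum_univ_succ, shapeFun, shape, refNode]
  ring

lemma sum_shapeFun (ξ : Plane) : ∑ i, shapeFun i ξ = 1 := by
  simp [Fin.sum_univ_succ, shapeFun, shape]
  ring

lemma sum_shapeFun_smul_refNode (ξ : Plane) :
    ∑ i, shapeFun i ξ • refNode (Fin.castSucc i) = ξ := by
  ext k
  fin_cases k <;> simp [Fin.sum_univ_succ, shapeFun, shape, refNode] <;> ring

/-- The partial derivatives of the shape functions. -/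
def shapePartial (ξ : Plane) : Fin 6 → ℝ × ℝ :=
  ![(-3 + 4 * ξ 0 + 4 * ξ 1, -3 + 4 * ξ 0 + 4 * ξ 1), (-1 + 4 * ξ 0, 0), (0, -1 + 4 * ξ 1),
    (4 - 4 * ξ 1 - 8 * ξ 0, -4 * ξ 0), (4 * ξ 1, 4 * ξ 0), (-4 * ξ 1, 4 - 4 * ξ 0 - 8 * ξ 1)]

/-- The derivatives of the shape functions. -/
def shapeDeriv (i : Fin 6) (ξ : Plane) : Plane →L[ℝ] ℝ :=
  (shapePartial ξ i).1 • EuclideanSpace.proj 0 + (shapePartial ξ i).2 • EuclideanSpace.proj 1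

lemma hasFDerivAt_shapeFun (i : Fin 6) (ξ : Plane) :
    HasFDerivAt (shapeFun i) (shapeDeriv i ξ) ξ := by
  have h0 : HasFDerivAt (fun ξ : Plane => ξ 0) (EuclideanSpace.proj 0 : Plane →L[ℝ] ℝ) ξ :=
    (EuclideanSpace.proj (𝕜 := ℝ) (0 : Fin 2)).hasFDerivAt
  have h1 : HasFDerivAt (fun ξ : Plane => ξ 1) (EuclideanSpace.proj 1 : Plane →L[ℝ] ℝ) ξ :=
    (EuclideanSpace.proj (𝕜 := ℝ) (1 : Fin 2)).hasFDerivAt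
  have h00 := h0.mul h0
  have h01 := h0.mul h1
  have h11 := h1.mul h1
  -- All six shape functions are instances of one general quadratic, so it is differentiated once.
  have key : ∀ c d e f g k : ℝ, HasFDerivAt (fun ξ : Plane => c + d * ξ 0 + e * ξ 1
      + f * (ξ 0 * ξ 0) + g * (ξ 0 * ξ 1) + k * (ξ 1 * ξ 1))
      ((d + 2 * f * ξ 0 + g * ξ 1) • (EuclideanSpace.proj 0 : Plane →L[ℝ] ℝ)
        + (e + g * ξ 0 + 2 * k * ξ 1) • (EuclideanSpace.proj 1 : Plane →L[ℝ] ℝ)) ξ := fun c d e f g k => by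
    have := (((((hasFDerivAt_const c ξ).add (h0.const_mul d)).add (h1.const_mul e)).add
      (h00.const_mul f)).add (h01.const_mul g)).add (h11.const_mul k)
    refine this.congr_fderiv ?_
    ext v
    simp
    ring
  fin_cases i
  · convert key 1 (-3) (-3) 2 4 2 using 1
    · funext x; simp [shapeFun, shape]; ring
    · ext v; simp [shapeDeriv, shapePartial, -mul_eq_mul_right_iff]; ring
  · convert key 0 (-1) 0 2 0 0 using 1
    · funext x; simp [shapeFun, shape]; ring
    · ext v; simp [shapeDeriv, shapePartial, -mul_eq_mul_right_iff]; ring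
  · convert key 0 0 (-1) 0 0 2 using 1
    · funext x; simp [shapeFun, shape]; ring
    · ext v; simp [shapeDeriv, shapePartial, -mul_eq_mul_right_iff]; ring
  · convert key 0 4 0 (-4) (-4) 0 using 1
    · funext x; simp [shapeFun, shape]; ring
    · ext v; simp [shapeDeriv, shapePartial, -mul_eq_mul_right_iff]; ring
  · convert key 0 0 0 0 4 0 using 1
    · funext x; simp [shapeFun, shape]; ring
    · ext v; simp [shapeDeriv, shapePartial]
  · convert key 0 0 4 0 (-4) (-4) using 1
    · funext x; simp [shapeFun, shape]; ring
    · ext v; simp [shapeDeriv, shapePartial, -mul_eq_mul_right_iff]; ring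

lemma abs_apply_le_norm (x : Plane) (i : Fin 2) : |x i| ≤ ‖x‖ := by
  simpa using PiLp.norm_apply_le x i

lemma norm_le_abs_add_abs (x : Plane) : ‖x‖ ≤ |x 0| + |x 1| := by
  conv_lhs => rw [plane_eq_sum x]
  refine (norm_add_le _ _).trans ?_
  simp [norm_smul]

/-- The ball of radius 3 leaves room for the reference triangle (norm at most 1) and all its small
perturbations. The numerical constants here and below are crude; only their independence of the mesh
matters. -/
lemma norm_shapeDeriv_le (i : Fin 6) {ξ : Plane} (hξ : ‖ξ‖ ≤ 3) : ‖shapeDeriv i ξ‖ ≤ 100 := by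
  have hb : |(shapePartial ξ i).1| + |(shapePartial ξ i).2| ≤ 100 := by
    have h0 := abs_le.1 ((abs_apply_le_norm ξ 0).trans hξ)
    have h1 := abs_le.1 ((abs_apply_le_norm ξ 1).trans hξ)
    have : |(shapePartial ξ i).1| ≤ 50 ∧ |(shapePartial ξ i).2| ≤ 50 := by
      fin_cases i <;> simp only [shapePartial, abs_le] <;> constructor <;> constructor <;> simp <;>
        linarith
    linarith [this.1, this.2]
  refine ContinuousLinearMap.opNorm_le_bound _ (by norm_num) fun v => ?_
  have h0 := abs_apply_le_norm v 0
  have h1 := abs_apply_le_norm v 1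
  calc ‖shapeDeriv i ξ v‖ = |(shapePartial ξ i).1 * v 0 + (shapePartial ξ i).2 * v 1| := by
        simp [shapeDeriv]
    _ ≤ |(shapePartial ξ i).1| * |v 0| + |(shapePartial ξ i).2| * |v 1| := by
        rw [← abs_mul, ← abs_mul]; exact abs_add_le _ _
    _ ≤ |(shapePartial ξ i).1| * ‖v‖ + |(shapePartial ξ i).2| * ‖v‖ := by gcongr
    _ ≤ 100 * ‖v‖ := by
        rw [← add_mul]; gcongr

lemma abs_shapeFun_sub_le (i : Fin 6) {ξ ζ : Plane} (hξ : ‖ξ‖ ≤ 3) (hζ : ‖ζ‖ ≤ 3) :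
    |shapeFun i ζ - shapeFun i ξ| ≤ 100 * ‖ζ - ξ‖ := by
  have := (convex_closedBall (0 : Plane) 3).norm_image_sub_le_of_norm_hasFDerivWithin_le
    (f := shapeFun i) (f' := shapeDeriv i) (C := 100) (x := ξ) (y := ζ)
    (fun x _ => (hasFDerivAt_shapeFun i x).hasFDerivWithinAt)
    (fun x hx => norm_shapeDeriv_le i (by simpa using hx)) (by simpa using hξ) (by simpa using hζ)
  simpa using this

lemma abs_shapeFun_le (i : Fin 6) {ξ : Plane} (hξ : ‖ξ‖ ≤ 3) : |shapeFun i ξ| ≤ 400 := by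
  have h := abs_shapeFun_sub_le i (ξ := 0) (by simp) hξ
  have h0 : |shapeFun i 0| ≤ 1 := by
    fin_cases i <;> simp [shapeFun, shape]
  have : |shapeFun i ξ| ≤ |shapeFun i ξ - shapeFun i 0| + |shapeFun i 0| := by
    simpa using abs_add_le (shapeFun i ξ - shapeFun i 0) (shapeFun i 0)
  rw [sub_zero] at h
  linarith

/-- The maximum of the nodal values of a function at the first six nodes. -/
def nodalNorm (f : Plane → ℝ) : ℝ := ‖fun i : Fin 6 => f (refNode i.castSucc)‖

lemma nodalNorm_nonneg (f : Plane → ℝ) : 0 ≤ nodalNorm f := norm_nonneg _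

lemma abs_le_nodalNorm (f : Plane → ℝ) (i : Fin 6) : |f (refNode i.castSucc)| ≤ nodalNorm f :=
  norm_le_pi_norm (fun i : Fin 6 => f (refNode i.castSucc)) i

lemma nodalNorm_le {f : Plane → ℝ} {r : ℝ} (hr : 0 ≤ r)
    (h : ∀ i : Fin 6, |f (refNode i.castSucc)| ≤ r) : nodalNorm f ≤ r :=
  (pi_norm_le_iff_of_nonneg hr).2 h

lemma IsQuad.abs_le {f : Plane → ℝ} (hf : IsQuad f) {ξ : Plane} (hξ : ‖ξ‖ ≤ 3) :
    |f ξ| ≤ 2400 * nodalNorm f := by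
  rw [hf.eq_sum_shapeFun ξ]
  calc |∑ i, shapeFun i ξ * f (refNode i.castSucc)|
      ≤ ∑ i : Fin 6, |shapeFun i ξ * f (refNode i.castSucc)| := Finset.abs_sum_le_sum_abs _ _
    _ ≤ ∑ i : Fin 6, 400 * nodalNorm f := by
        refine Finset.sum_le_sum fun i _ => ?_
        rw [abs_mul]
        exact mul_le_mul (abs_shapeFun_le i hξ) (abs_le_nodalNorm f i) (abs_nonneg _) (by norm_num)
    _ = 2400 * nodalNorm f := by simp; ring

lemma IsQuad.abs_sub_le {f : Plane → ℝ} (hf : IsQuad f) {ξ ζ : Plane} (hξ : ‖ξ‖ ≤ 3)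
    (hζ : ‖ζ‖ ≤ 3) : |f ζ - f ξ| ≤ 600 * nodalNorm f * ‖ζ - ξ‖ := by
  rw [hf.eq_sum_shapeFun ξ, hf.eq_sum_shapeFun ζ, ← Finset.sum_sub_distrib]
  calc |∑ i, (shapeFun i ζ * f (refNode i.castSucc) - shapeFun i ξ * f (refNode i.castSucc))|
      ≤ ∑ i : Fin 6, |shapeFun i ζ * f (refNode i.castSucc)
          - shapeFun i ξ * f (refNode i.castSucc)| := Finset.abs_sum_le_sum_abs _ _
    _ ≤ ∑ i : Fin 6, (100 * ‖ζ - ξ‖) * nodalNorm f := by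
        refine Finset.sum_le_sum fun i _ => ?_
        rw [← sub_mul, abs_mul]
        exact mul_le_mul (abs_shapeFun_sub_le i hξ hζ) (abs_le_nodalNorm f i) (abs_nonneg _)
          (by positivity)
    _ = 600 * nodalNorm f * ‖ζ - ξ‖ := by simp; ring

lemma norm_le_one_of_mem_refTri {ξ : Plane} (hξ : ξ ∈ refTri) : ‖ξ‖ ≤ 1 := by
  refine (norm_le_abs_add_abs ξ).trans ?_
  rw [abs_of_nonneg hξ.1, abs_of_nonneg hξ.2.1]
  exact hξ.2.2

lemma refNode_mem (q : Fin 7) : refNode q ∈ refTri := by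
  fin_cases q <;> simp [refNode, refTri] <;> norm_num

lemma convex_refTri : Convex ℝ refTri := by
  intro x hx y hy s t hs ht hst
  obtain ⟨h1, h2, h3⟩ := hx
  obtain ⟨k1, k2, k3⟩ := hy
  refine ⟨?_, ?_, ?_⟩
  · simp; positivity
  · simp; positivity
  · simp
    nlinarith [mul_le_mul_of_nonneg_left h3 hs, mul_le_mul_of_nonneg_left k3 ht]

lemma isClosed_refTri : IsClosed refTri := by
  have h : ∀ i : Fin 2, Continuous fun ξ : Plane => ξ i := fun i => by fun_prop
  exact (isClosed_le continuous_const (h 0)).inter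
    ((isClosed_le continuous_const (h 1)).inter (isClosed_le ((h 0).add (h 1)) continuous_const))

lemma isCompact_refTri : IsCompact refTri :=
  Metric.isCompact_of_isClosed_isBounded isClosed_refTri
    ((Metric.isBounded_closedBall (x := (0 : Plane)) (r := 1)).subset fun ξ hξ => by
      simpa using norm_le_one_of_mem_refTri hξ)

lemma interior_refTri_nonempty : (interior refTri).Nonempty := by
  refine ⟨!₂[1 / 3, 1 / 3], ?_⟩
  have h : ∀ i : Fin 2, Continuous fun ξ : Plane => ξ i := fun i => by fun_prop
  have ho : IsOpen {ξ : Plane | 0 < ξ 0 ∧ 0 < ξ 1 ∧ ξ 0 + ξ 1 < 1} :=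
    (isOpen_lt continuous_const (h 0)).inter
      ((isOpen_lt continuous_const (h 1)).inter (isOpen_lt ((h 0).add (h 1)) continuous_const))
  have hsub : {ξ : Plane | 0 < ξ 0 ∧ 0 < ξ 1 ∧ ξ 0 + ξ 1 < 1} ⊆ refTri :=
    fun ξ h => ⟨h.1.le, h.2.1.le, h.2.2.le⟩
  refine interior_maximal hsub ho ?_
  simp
  norm_num

/-- A continuous function that vanishes almost everywhere on an open set vanishes there identically,
and a convex set with nonempty interior lies in the closure of that interior. -/
lemma eq_zero_of_setIntegral_sq_eq_zero {K : Set Plane} (hK : IsCompact K) (hKc : Convex ℝ K)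
    (hKi : (interior K).Nonempty) {f : Plane → ℝ} (hf : Continuous f)
    (h : ∫ x in K, f x * f x = 0) : ∀ x ∈ K, f x = 0 := by
  have hint : IntegrableOn (fun x => f x * f x) K := (hf.mul hf).continuousOn.integrableOn_compact hK
  have h0 := (setIntegral_eq_zero_iff_of_nonneg_ae
    (Filter.Eventually.of_forall fun x => mul_self_nonneg (f x)) hint).1 h
  have h1 : ∀ᵐ x ∂(volume.restrict (interior K)), f x = 0 := by
    have := ae_restrict_of_ae_restrict_of_subset interior_subset h0
    filter_upwards [this] with x hx
    simpa using hx
  have h2 : EqOn f (fun _ => 0) (interior K) :=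
    Measure.eqOn_open_of_ae_eq h1 isOpen_interior hf.continuousOn continuousOn_const
  have h3 : EqOn f (fun _ => 0) (closure (interior K)) :=
    h2.closure hf continuous_const
  intro x hx
  refine h3 ?_
  rw [hKc.closure_interior_eq_closure_of_nonempty_interior hKi]
  exact subset_closure hx

/-- On quadratic functions the `L²` norm over the reference triangle dominates the nodal norm. -/
lemma exists_coercivity : ∃ c : ℝ, 0 < c ∧ ∀ f : Plane → ℝ, IsQuad f →
    c * nodalNorm f ^ 2 ≤ ∫ ξ in refTri, f ξ * f ξ := by
  let P : (Fin 6 → ℝ) → Plane → ℝ := fun z ξ => ∑ i, shapeFun i ξ * z i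
  have hsc : ∀ i, Continuous (shapeFun i) := fun i =>
    continuous_iff_continuousAt.2 fun ξ => (hasFDerivAt_shapeFun i ξ).continuousAt
  have hPc : ∀ z, Continuous (P z) := fun z => by
    exact continuous_finsetSum _ fun i _ => (hsc i).mul continuous_const
  let m : Fin 6 → Fin 6 → ℝ := fun i j => ∫ ξ in refTri, shapeFun i ξ * shapeFun j ξ
  have hI : ∀ z, ∫ ξ in refTri, P z ξ * P z ξ = ∑ i, ∑ j, m i j * (z i * z j) := fun z => by
    have : ∀ ξ, P z ξ * P z ξ = ∑ i, ∑ j, shapeFun i ξ * shapeFun j ξ * (z i * z j) := fun ξ => by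
      simp only [P, Finset.sum_mul_sum]
      exact Finset.sum_congr rfl fun i _ => Finset.sum_congr rfl fun j _ => by ring
    simp only [this]
    have hin : ∀ i j, IntegrableOn (fun ξ => shapeFun i ξ * shapeFun j ξ * (z i * z j)) refTri :=
      fun i j => (((hsc i).mul (hsc j)).mul continuous_const).continuousOn.integrableOn_compact
        isCompact_refTri
    rw [integral_finsetSum _ fun i _ => integrable_finsetSum _ fun j _ => hin i j]
    refine Finset.sum_congr rfl fun i _ => ?_
    rw [integral_finsetSum _ fun j _ => hin i j]
    refine Finset.sum_congr rfl fun j _ => ?_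
    rw [integral_mul_const]
  -- The mass form becomes a continuous quadratic form in the nodal values. Its minimum on the
  -- compact unit sphere is the coercivity constant, and homogeneity extends the bound to all z.
  let Q : (Fin 6 → ℝ) → ℝ := fun z => ∑ i, ∑ j, m i j * (z i * z j)
  have hQc : Continuous Q := by fun_prop
  have hne : (Metric.sphere (0 : Fin 6 → ℝ) 1).Nonempty := NormedSpace.sphere_nonempty.2 (by norm_num)
  obtain ⟨z₀, hz₀, hmin⟩ := (isCompact_sphere (0 : Fin 6 → ℝ) 1).exists_isMinOn hne hQc.continuousOn
  have hnode : ∀ z i, P z (refNode (Fin.castSucc i)) = z i := fun z i => by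
    fin_cases i <;> simp [P, Fin.sum_univ_succ, shapeFun, shape, refNode] <;> norm_num
  have hQ0 : 0 ≤ Q z₀ := by
    simp only [Q]
    rw [← hI]
    exact integral_nonneg fun ξ => mul_self_nonneg _
  have hpos : 0 < Q z₀ := by
    refine lt_of_le_of_ne hQ0 fun h => ?_
    have h1 := eq_zero_of_setIntegral_sq_eq_zero isCompact_refTri convex_refTri
      interior_refTri_nonempty (hPc z₀) (by rw [hI]; exact h.symm)
    have : z₀ = 0 := funext fun i => by
      rw [← hnode z₀ i]
      exact h1 _ (refNode_mem _)
    simp [this] at hz₀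
  refine ⟨Q z₀, hpos, fun f hf => ?_⟩
  set z : Fin 6 → ℝ := fun i => f (refNode i.castSucc) with hz
  have hfz : ∫ ξ in refTri, f ξ * f ξ = Q z := by
    simp only [Q]
    rw [← hI]
    refine integral_congr_ae (Filter.Eventually.of_forall fun ξ => ?_)
    simp only [P]
    rw [hf.eq_sum_shapeFun ξ]
  rw [hfz]
  change Q z₀ * ‖z‖ ^ 2 ≤ Q z
  rcases eq_or_ne z 0 with h0 | h0
  · simp [h0, Q]
  have hzn : 0 < ‖z‖ := norm_pos_iff.2 h0
  have h1 : Q z₀ ≤ Q (‖z‖⁻¹ • z) := hmin (by simp [norm_smul, hzn.ne'])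
  have h2 : Q (‖z‖⁻¹ • z) = Q z / ‖z‖ ^ 2 := by
    simp only [Q, Finset.sum_div]
    refine Finset.sum_congr rfl fun i _ => Finset.sum_congr rfl fun j _ => ?_
    simp
    field_simp
  rw [h2, le_div_iff₀ (by positivity)] at h1
  exact h1

/-! ### Perturbations of the nodes -/

/-- The perturbation of the identity that interpolates the nodal displacements `ρ`. -/
def perturb (ρ : Fin 7 → Plane) (ξ : Plane) : Plane := ξ + ∑ i : Fin 6, shapeFun i ξ • ρ i.castSucc

/-- The derivative of `perturb ρ` minus the identity. -/
def perturbDeriv (ρ : Fin 7 → Plane) (ξ : Plane) : Plane →L[ℝ] Plane :=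
  ∑ i : Fin 6, (shapeDeriv i ξ).smulRight (ρ i.castSucc)

lemma hasFDerivAt_perturb (ρ : Fin 7 → Plane) (ξ : Plane) :
    HasFDerivAt (perturb ρ) (ContinuousLinearMap.id ℝ Plane + perturbDeriv ρ ξ) ξ := by
  refine (hasFDerivAt_id ξ).add ?_
  exact HasFDerivAt.fun_sum fun i _ => (hasFDerivAt_shapeFun i ξ).smul_const _

lemma norm_perturbDeriv_le {ρ : Fin 7 → Plane} {ε : ℝ} (hρ : ∀ q, ‖ρ q‖ ≤ ε) {ξ : Plane}
    (hξ : ‖ξ‖ ≤ 3) : ‖perturbDeriv ρ ξ‖ ≤ 600 * ε := by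
  refine (norm_sum_le _ _).trans ?_
  calc ∑ i : Fin 6, ‖(shapeDeriv i ξ).smulRight (ρ i.castSucc)‖ ≤ ∑ i : Fin 6, 100 * ε := by
        refine Finset.sum_le_sum fun i _ => ?_
        rw [ContinuousLinearMap.norm_smulRight_apply]
        exact mul_le_mul (norm_shapeDeriv_le i hξ) (hρ _) (norm_nonneg _) (by norm_num)
    _ = 600 * ε := by simp; ring

lemma norm_perturb_sub_le {ρ : Fin 7 → Plane} {ε : ℝ} (hρ : ∀ q, ‖ρ q‖ ≤ ε) {ξ : Plane}
    (hξ : ‖ξ‖ ≤ 3) : ‖perturb ρ ξ - ξ‖ ≤ 2400 * ε := by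
  simp only [perturb, add_sub_cancel_left]
  refine (norm_sum_le _ _).trans ?_
  calc ∑ i : Fin 6, ‖shapeFun i ξ • ρ i.castSucc‖ ≤ ∑ i : Fin 6, 400 * ε := by
        refine Finset.sum_le_sum fun i _ => ?_
        rw [norm_smul]
        exact mul_le_mul (abs_shapeFun_le i hξ) (hρ _) (norm_nonneg _) (by norm_num)
    _ = 2400 * ε := by simp; ring

/-- The difference between `perturb ρ` and the identity is a strict contraction, so two points with
the same image must coincide. -/
lemma perturb_injOn {ρ : Fin 7 → Plane} {ε : ℝ} (hρ : ∀ q, ‖ρ q‖ ≤ ε) (hε : 600 * ε < 1) :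
    InjOn (perturb ρ) refTri := by
  intro ξ hξ ζ hζ h
  have hξ1 := norm_le_one_of_mem_refTri hξ
  have hζ1 := norm_le_one_of_mem_refTri hζ
  have := (convex_closedBall (0 : Plane) 3).norm_image_sub_le_of_norm_hasFDerivWithin_le
    (f := fun x => perturb ρ x - x) (f' := perturbDeriv ρ) (C := 600 * ε) (x := ξ) (y := ζ)
    (fun x _ => (((hasFDerivAt_perturb ρ x).sub (hasFDerivAt_id x)).congr_fderiv
      (add_sub_cancel_left _ _)).hasFDerivWithinAt)
    (fun x hx => norm_perturbDeriv_le hρ (by simpa using hx))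
    (by simp; linarith) (by simp; linarith)
  simp only [h] at this
  rw [show perturb ρ ζ - ζ - (perturb ρ ζ - ξ) = -(ζ - ξ) by abel, norm_neg] at this
  by_contra hne
  have hpos : 0 < ‖ζ - ξ‖ := norm_pos_iff.2 (sub_ne_zero.2 (Ne.symm hne))
  nlinarith

/-- Least-squares fits at slightly perturbed nodes reproduce quadratics up to the size of the
perturbation. -/
lemma nodalNorm_fit_sub_le {ρ : Fin 7 → Plane} {ε : ℝ} (hρ : ∀ q, ‖ρ q‖ ≤ ε) (hε : 1200 * ε ≤ 1)
    {f F : Plane → ℝ} (hf : IsQuad f) (hF : IsQuad F)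
    (h : ∑ q, (f (refNode q + ρ q) - F (refNode q)) ^ 2
      ≤ ∑ q, (F (refNode q + ρ q) - F (refNode q)) ^ 2) :
    nodalNorm (fun ξ => f ξ - F ξ) ≤ 4800 * ε * nodalNorm F := by
  have hε0 : 0 ≤ ε := (norm_nonneg _).trans (hρ 0)
  have hn : ∀ q, ‖refNode q‖ ≤ 1 := fun q => norm_le_one_of_mem_refTri (refNode_mem q)
  have hn3 : ∀ q, ‖refNode q‖ ≤ 3 := fun q => (hn q).trans (by norm_num)
  have hp3 : ∀ q, ‖refNode q + ρ q‖ ≤ 3 := fun q =>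
    (norm_add_le _ _).trans (by linarith [hn q, hρ q])
  have hm := nodalNorm_nonneg F
  have hstep : ∀ {G : Plane → ℝ}, IsQuad G → ∀ q,
      |G (refNode q + ρ q) - G (refNode q)| ≤ 600 * ε * nodalNorm G := fun {G} hG q => by
    refine (hG.abs_sub_le (hn3 q) (hp3 q)).trans ?_
    rw [add_sub_cancel_left]
    nlinarith [mul_le_mul_of_nonneg_left (hρ q) (nodalNorm_nonneg G)]
  have h7 : ∑ q, (F (refNode q + ρ q) - F (refNode q)) ^ 2 ≤ 7 * (600 * ε * nodalNorm F) ^ 2 := by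
    calc _ ≤ ∑ q : Fin 7, (600 * ε * nodalNorm F) ^ 2 := by
          refine Finset.sum_le_sum fun q _ => ?_
          rw [← sq_abs (F _ - _)]
          exact pow_le_pow_left₀ (abs_nonneg _) (hstep hF q) 2
      _ = _ := by simp
  -- F itself is a competitor in the minimization, so each residual of f is bounded by the full
  -- residual of F; 1800 is an upper bound for √7 · 600.
  have hq : ∀ q, |f (refNode q + ρ q) - F (refNode q)| ≤ 1800 * ε * nodalNorm F := fun q => by
    refine abs_le_of_sq_le_sq ?_ (by positivity)
    have h1 : (f (refNode q + ρ q) - F (refNode q)) ^ 2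
        ≤ ∑ q, (f (refNode q + ρ q) - F (refNode q)) ^ 2 :=
      Finset.single_le_sum (f := fun q => (f (refNode q + ρ q) - F (refNode q)) ^ 2)
        (fun q _ => sq_nonneg _) (Finset.mem_univ q)
    nlinarith [sq_nonneg (ε * nodalNorm F)]
  set d : Plane → ℝ := fun ξ => f ξ - F ξ with hd
  have hdq : IsQuad d := hf.sub hF
  have h1 : nodalNorm d ≤ 600 * ε * nodalNorm d + 2400 * ε * nodalNorm F := by
    refine nodalNorm_le (by have := nodalNorm_nonneg d; positivity) fun i => ?_
    have e1 := abs_le.1 (hstep hdq i.castSucc)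
    have e2 := abs_le.1 (hq i.castSucc)
    have e3 := abs_le.1 (hstep hF i.castSucc)
    simp only [hd] at e1 ⊢
    rw [abs_le]
    constructor <;> linarith [e1.1, e1.2, e2.1, e2.2, e3.1, e3.2]
  -- The displacement error of d itself is absorbed on the left, which doubles the constant 2400 =
  -- 1800 + 600.
  have h2 : 600 * ε * nodalNorm d ≤ 1 / 2 * nodalNorm d :=
    mul_le_mul_of_nonneg_right (by linarith) (nodalNorm_nonneg d)
  linarith

/-! ### Uniform estimates on compact sets -/

section Compact

variable {E F : Type*} [NormedAddCommGroup E] [NormedSpace ℝ E] [NormedAddCommGroup F]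
  [NormedSpace ℝ F]

/-- The closure of Ω need not be convex, so the mean value inequality is not available on S; a
locally Lipschitz function on a compact set is nevertheless globally Lipschitz there. -/
lemma exists_lipschitz_bound {S U : Set E} (hS : IsCompact S) (hU : IsOpen U) (hSU : S ⊆ U)
    {f : E → F} (hf : ContDiffOn ℝ 1 f U) :
    ∃ C : ℝ, 0 ≤ C ∧ ∀ p ∈ S, ∀ q ∈ S, ‖f q - f p‖ ≤ C * ‖q - p‖ := by
  have hl : LocallyLipschitzOn S f := fun x hx => by
    obtain ⟨K, t, ht, hK⟩ := (hf.contDiffAt (hU.mem_nhds (hSU hx))).exists_lipschitzOnWith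
    exact ⟨K, t, mem_nhdsWithin_of_mem_nhds ht, hK⟩
  obtain ⟨K, hK⟩ := hl.exists_lipschitzOnWith_of_compact hS
  exact ⟨K, K.2, fun p hp q hq => hK.norm_sub_le hq hp⟩

/-- The segment from p to q may leave S. If the points are within δ it stays in a thickening inside
U, and the mean value inequality applies. If they are farther apart, a bound linear in the distance
suffices, since then 1 ≤ ‖q - p‖ / δ. -/
lemma exists_taylor_bound [ProperSpace E] {S U : Set E} (hS : IsCompact S) (hU : IsOpen U)
    (hSU : S ⊆ U) {f : E → F} (hf : ContDiffOn ℝ 2 f U) :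
    ∃ C : ℝ, 0 ≤ C ∧ ∀ p ∈ S, ∀ q ∈ S,
      ‖f q - f p - fderiv ℝ f p (q - p)‖ ≤ C * ‖q - p‖ ^ 2 := by
  obtain ⟨δ, hδ, hδU⟩ := hS.exists_cthickening_subset_open hU hSU
  have hf' : ContDiffOn ℝ 1 (fderiv ℝ f) U := hf.fderiv_of_isOpen hU (by norm_num)
  obtain ⟨C₁, hC₁, h₁⟩ := exists_lipschitz_bound (hS.cthickening (r := δ)) hU hδU hf'
  obtain ⟨C₂, hC₂, h₂⟩ := exists_lipschitz_bound hS hU hSU (hf.of_le (by norm_num))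
  obtain ⟨C₃, h₃⟩ := hS.exists_bound_of_continuousOn (hf'.continuousOn.mono hSU)
  have hpos : 0 ≤ (C₂ + |C₃|) / δ := by positivity
  refine ⟨C₁ + (C₂ + |C₃|) / δ, by positivity, fun p hp q hq => ?_⟩
  rcases le_or_gt ‖q - p‖ δ with h | h
  · have hball : Metric.closedBall p ‖q - p‖ ⊆ Metric.cthickening δ S :=
      (Metric.closedBall_subset_closedBall h).trans (Metric.closedBall_subset_cthickening hp δ)
    have hpS : p ∈ Metric.cthickening δ S := hball (Metric.mem_closedBall_self (norm_nonneg _))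
    have := (convex_closedBall p ‖q - p‖).norm_image_sub_le_of_norm_hasFDerivWithin_le'
      (f := f) (f' := fderiv ℝ f) (φ := fderiv ℝ f p) (C := C₁ * ‖q - p‖) (x := p) (y := q)
      (fun x hx => ((hf.contDiffAt (hU.mem_nhds (hδU (hball hx)))).differentiableAt
        (by norm_num)).hasFDerivAt.hasFDerivWithinAt)
      (fun x hx => (h₁ p hpS x (hball hx)).trans
        (mul_le_mul_of_nonneg_left (mem_closedBall_iff_norm.1 hx) hC₁))
      (Metric.mem_closedBall_self (norm_nonneg _)) (mem_closedBall_iff_norm.2 le_rfl)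
    nlinarith [sq_nonneg ‖q - p‖]
  · have h4 : ‖fderiv ℝ f p (q - p)‖ ≤ |C₃| * ‖q - p‖ :=
      (ContinuousLinearMap.le_opNorm _ _).trans
        (mul_le_mul_of_nonneg_right ((h₃ p hp).trans (le_abs_self _)) (norm_nonneg _))
    have h5 : (C₂ + |C₃|) * ‖q - p‖ ≤ (C₂ + |C₃|) / δ * ‖q - p‖ ^ 2 := by
      have h6 : (C₂ + |C₃|) * ‖q - p‖ = (C₂ + |C₃|) / δ * (δ * ‖q - p‖) := by field_simp
      rw [h6]
      refine mul_le_mul_of_nonneg_left ?_ hpos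
      rw [pow_two]
      exact mul_le_mul_of_nonneg_right h.le (norm_nonneg _)
    have h7 := norm_sub_le (f q - f p) (fderiv ℝ f p (q - p))
    have h8 := h₂ p hp q hq
    nlinarith [mul_nonneg hC₁ (sq_nonneg ‖q - p‖)]

end Compact

/-! ### The data of the transport problem -/

/-- The velocity field. -/
def velocity (a b : Plane × ℝ → ℝ) (p : Plane × ℝ) : Plane := !₂[a p, b p]

/-- The acceleration along characteristics. -/
def accel (A : Plane × ℝ → Plane) (p : Plane × ℝ) : Plane := fderiv ℝ A p (A p, 1)

/-- The spatial derivative of the velocity field. -/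
def spaceDeriv (A : Plane × ℝ → Plane) (p : Plane × ℝ) : Plane →L[ℝ] Plane :=
  (fderiv ℝ A p).comp (ContinuousLinearMap.inl ℝ Plane ℝ)

/-- The divergence of a linear vector field. -/
def divg (M : Plane →L[ℝ] Plane) : ℝ :=
  M (EuclideanSpace.single 0 1) 0 + M (EuclideanSpace.single 1 1) 1

/-- The bounds on the coefficients and on the exact solution that enter the error estimate. -/
structure DataBounds (S : Set (Plane × ℝ)) (A : Plane × ℝ → Plane) (u : Plane × ℝ → ℝ)
    (C : ℝ) : Prop where
  one_le : 1 ≤ C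
  diff_vel : ∀ p ∈ S, DifferentiableAt ℝ A p
  cont : ContinuousOn u S
  vel_le : ∀ p ∈ S, ‖A p‖ ≤ C
  dvel_le : ∀ p ∈ S, ‖fderiv ℝ A p‖ ≤ C
  accel_le : ∀ p ∈ S, ‖accel A p‖ ≤ C
  sol_le : ∀ p ∈ S, |u p| ≤ C
  dsol_le : ∀ p ∈ S, ‖fderiv ℝ u p‖ ≤ C
  accel_lip : ∀ p ∈ S, ∀ q ∈ S, ‖accel A q - accel A p‖ ≤ C * ‖q - p‖
  dsol_lip : ∀ p ∈ S, ∀ q ∈ S, ‖fderiv ℝ u q - fderiv ℝ u p‖ ≤ C * ‖q - p‖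
  vel_taylor : ∀ p ∈ S, ∀ q ∈ S, ‖A q - A p - fderiv ℝ A p (q - p)‖ ≤ C * ‖q - p‖ ^ 2
  sol_taylor : ∀ p ∈ S, ∀ q ∈ S, |u q - u p - fderiv ℝ u p (q - p)| ≤ C * ‖q - p‖ ^ 2
  pde : ∀ p ∈ S, fderiv ℝ u p (A p, 1) + u p * divg (spaceDeriv A p) = 0

/-- The product rule turns the conservative form into the advective one: the derivative of u along
characteristics plus u times the divergence of the velocity. -/
lemma conservation_form {a b u : Plane × ℝ → ℝ} {x : Plane} {t : ℝ}
    (ha : DifferentiableAt ℝ a (x, t)) (hb : DifferentiableAt ℝ b (x, t))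
    (hu : DifferentiableAt ℝ u (x, t)) :
    deriv (fun s => u (x, s)) t
      + lineDeriv ℝ (fun y => a (y, t) * u (y, t)) x (EuclideanSpace.single 0 1)
      + lineDeriv ℝ (fun y => b (y, t) * u (y, t)) x (EuclideanSpace.single 1 1)
    = fderiv ℝ u (x, t) (velocity a b (x, t), 1)
      + u (x, t) * divg (spaceDeriv (velocity a b) (x, t)) := by
  have hs : HasFDerivAt (fun s : ℝ => ((x, s) : Plane × ℝ)) (ContinuousLinearMap.inr ℝ Plane ℝ) t :=
    hasFDerivAt_prodMk_right x t
  have hy : HasFDerivAt (fun y : Plane => ((y, t) : Plane × ℝ)) (ContinuousLinearMap.inl ℝ Plane ℝ)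
      x := hasFDerivAt_prodMk_left x t
  have h1 : deriv (fun s => u (x, s)) t = fderiv ℝ u (x, t) (0, 1) := by
    have := (HasFDerivAt.comp t (f := fun s : ℝ => ((x, s) : Plane × ℝ)) hu.hasFDerivAt
      hs).hasDerivAt.deriv
    simpa [Function.comp_def] using this
  have h2 : ∀ (c : Plane × ℝ → ℝ), DifferentiableAt ℝ c (x, t) → ∀ v : Plane,
      lineDeriv ℝ (fun y => c (y, t) * u (y, t)) x v
      = c (x, t) * fderiv ℝ u (x, t) (v, 0) + u (x, t) * fderiv ℝ c (x, t) (v, 0) :=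
    fun c hc v => by
    have e1 := HasFDerivAt.comp x (f := fun y : Plane => ((y, t) : Plane × ℝ)) hc.hasFDerivAt hy
    have e2 := HasFDerivAt.comp x (f := fun y : Plane => ((y, t) : Plane × ℝ)) hu.hasFDerivAt hy
    have := ((e1.mul e2).hasLineDerivAt v).lineDeriv
    simpa [Function.comp_def, Pi.mul_def] using this
  have hA : DifferentiableAt ℝ (velocity a b) (x, t) := by
    refine differentiableAt_euclidean.2 fun i => ?_
    fin_cases i
    · simpa [velocity] using ha
    · simpa [velocity] using hb
  have hA0 : ∀ v, fderiv ℝ a (x, t) v = fderiv ℝ (velocity a b) (x, t) v 0 := fun v => by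
    have : HasFDerivAt a _ (x, t) :=
      (EuclideanSpace.proj (𝕜 := ℝ) (0 : Fin 2)).hasFDerivAt.comp (x, t) hA.hasFDerivAt
    rw [this.fderiv]
    simp
  have hA1 : ∀ v, fderiv ℝ b (x, t) v = fderiv ℝ (velocity a b) (x, t) v 1 := fun v => by
    have : HasFDerivAt b _ (x, t) :=
      (EuclideanSpace.proj (𝕜 := ℝ) (1 : Fin 2)).hasFDerivAt.comp (x, t) hA.hasFDerivAt
    rw [this.fderiv]
    simp
  have hv : ((velocity a b (x, t), 1) : Plane × ℝ) =
      a (x, t) • ((EuclideanSpace.single 0 1 : Plane), (0 : ℝ))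
      + b (x, t) • ((EuclideanSpace.single 1 1 : Plane), (0 : ℝ)) + ((0 : Plane), (1 : ℝ)) := by
    have := plane_eq_sum (velocity a b (x, t))
    ext i
    · simp [velocity]
      fin_cases i <;> simp
    · simp
  rw [h1, h2 a ha, h2 b hb, hv, map_add, map_add, map_smul, map_smul, hA0, hA1]
  simp only [divg, spaceDeriv, smul_eq_mul]
  simp
  ring

/-- By smoothness near the compact cylinder, one constant, fixed before any mesh is chosen, serves
all the bounds. -/
lemma exists_dataBounds {Ω : Set Plane} (hΩb : Bornology.IsBounded Ω) {T : ℝ}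
    {a b u : Plane × ℝ → ℝ} (ha : SmoothOnCylinder Ω T a) (hb : SmoothOnCylinder Ω T b)
    (hu : SmoothOnCylinder Ω T u) (hpde : SolvesTransport Ω T a b u) :
    ∃ C, DataBounds (closure Ω ×ˢ Icc 0 T) (velocity a b) u C := by
  obtain ⟨Ua, hUa, hSa, ha⟩ := ha
  obtain ⟨Ub, hUb, hSb, hb⟩ := hb
  obtain ⟨Uu, hUu, hSu, hu⟩ := hu
  set S : Set (Plane × ℝ) := closure Ω ×ˢ Icc 0 T with hSdef
  have hS : IsCompact S := hΩb.isCompact_closure.prod isCompact_Icc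
  set U := Ua ∩ Ub ∩ Uu with hUdef
  have hU : IsOpen U := (hUa.inter hUb).inter hUu
  have hSU : S ⊆ U := fun p hp => ⟨⟨hSa hp, hSb hp⟩, hSu hp⟩
  replace ha : ContDiffOn ℝ ∞ a U := ha.mono fun p hp => hp.1.1
  replace hb : ContDiffOn ℝ ∞ b U := hb.mono fun p hp => hp.1.2
  replace hu : ContDiffOn ℝ ∞ u U := hu.mono fun p hp => hp.2
  set A := velocity a b with hAdef
  have hA : ContDiffOn ℝ ∞ A U := contDiffOn_euclidean.2 fun i => by
    fin_cases i
    · simpa [hAdef, velocity] using ha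
    · simpa [hAdef, velocity] using hb
  have hDA : ContDiffOn ℝ ∞ (fderiv ℝ A) U := hA.fderiv_of_isOpen hU (by simp)
  have hDu : ContDiffOn ℝ ∞ (fderiv ℝ u) U := hu.fderiv_of_isOpen hU (by simp)
  have hB : ContDiffOn ℝ ∞ (accel A) U := hDA.clm_apply (hA.prodMk contDiffOn_const)
  have le1 : (1 : WithTop ℕ∞) ≤ ∞ := WithTop.coe_le_coe.2 le_top
  have le2 : (2 : WithTop ℕ∞) ≤ ∞ := WithTop.coe_le_coe.2 le_top
  obtain ⟨C₁, h₁⟩ := hS.exists_bound_of_continuousOn (hA.continuousOn.mono hSU)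
  obtain ⟨C₂, h₂⟩ := hS.exists_bound_of_continuousOn (hDA.continuousOn.mono hSU)
  obtain ⟨C₃, h₃⟩ := hS.exists_bound_of_continuousOn (hB.continuousOn.mono hSU)
  obtain ⟨C₄, h₄⟩ := hS.exists_bound_of_continuousOn (hu.continuousOn.mono hSU)
  obtain ⟨C₅, h₅⟩ := hS.exists_bound_of_continuousOn (hDu.continuousOn.mono hSU)
  obtain ⟨C₆, -, h₆⟩ := exists_lipschitz_bound hS hU hSU (hB.of_le le1)
  obtain ⟨C₇, -, h₇⟩ := exists_lipschitz_bound hS hU hSU (hDu.of_le le1)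
  obtain ⟨C₈, -, h₈⟩ := exists_taylor_bound hS hU hSU (hA.of_le le2)
  obtain ⟨C₉, -, h₉⟩ := exists_taylor_bound hS hU hSU (hu.of_le le2)
  set C := 1 + |C₁| + |C₂| + |C₃| + |C₄| + |C₅| + |C₆| + |C₇| + |C₈| + |C₉| with hC
  have n1 := abs_nonneg C₁
  have n2 := abs_nonneg C₂
  have n3 := abs_nonneg C₃
  have n4 := abs_nonneg C₄
  have n5 := abs_nonneg C₅
  have n6 := abs_nonneg C₆
  have n7 := abs_nonneg C₇
  have n8 := abs_nonneg C₈
  have n9 := abs_nonneg C₉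
  have hdiff : ∀ {G : Type} [NormedAddCommGroup G] [NormedSpace ℝ G] {f : Plane × ℝ → G},
      ContDiffOn ℝ ∞ f U → ∀ p ∈ S, DifferentiableAt ℝ f p := fun hf p hp =>
    (hf.contDiffAt (hU.mem_nhds (hSU hp))).differentiableAt (by simp)
  refine ⟨C, ?_, fun p hp => hdiff hA p hp, hu.continuousOn.mono hSU,
    fun p hp => (h₁ p hp).trans ?_, fun p hp => (h₂ p hp).trans ?_, fun p hp => (h₃ p hp).trans ?_,
    fun p hp => (h₄ p hp).trans ?_, fun p hp => (h₅ p hp).trans ?_,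
    fun p hp q hq => (h₆ p hp q hq).trans (mul_le_mul_of_nonneg_right ?_ (norm_nonneg _)),
    fun p hp q hq => (h₇ p hp q hq).trans (mul_le_mul_of_nonneg_right ?_ (norm_nonneg _)),
    fun p hp q hq => (h₈ p hp q hq).trans (mul_le_mul_of_nonneg_right ?_ (by positivity)),
    fun p hp q hq => (h₉ p hp q hq).trans (mul_le_mul_of_nonneg_right ?_ (by positivity)), ?_⟩
  · linarith
  · linarith [le_abs_self C₁]
  · linarith [le_abs_self C₂]
  · linarith [le_abs_self C₃]
  · linarith [le_abs_self C₄]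
  · linarith [le_abs_self C₅]
  · linarith [le_abs_self C₆]
  · linarith [le_abs_self C₇]
  · linarith [le_abs_self C₈]
  · linarith [le_abs_self C₉]
  -- The equation is given on Ω only; at each fixed time both sides are continuous up to the
  -- boundary, so it extends to the closure.
  · rintro ⟨x, t⟩ ⟨hx, ht⟩
    have hmaps : MapsTo (fun y : Plane => ((y, t) : Plane × ℝ)) (closure Ω) U :=
      fun y hy => hSU ⟨hy, ht⟩
    have hpair : ContinuousOn (fun y : Plane => ((y, t) : Plane × ℝ)) (closure Ω) := by fun_prop
    have hcA := hA.continuousOn.comp hpair hmaps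
    have hcu := hu.continuousOn.comp hpair hmaps
    have hcDA := hDA.continuousOn.comp hpair hmaps
    have hcDu := hDu.continuousOn.comp hpair hmaps
    have hev : ∀ (v : Plane × ℝ) (i : Fin 2),
        ContinuousOn (fun y => fderiv ℝ A (y, t) v i) (closure Ω) := fun v i => by
      have h1 : ContinuousOn (fun y => fderiv ℝ A (y, t) v) (closure Ω) :=
        hcDA.clm_apply continuousOn_const
      have h2 : Continuous fun z : Plane => z i := by fun_prop
      exact h2.comp_continuousOn h1
    have hcont : ContinuousOn (fun y : Plane => fderiv ℝ u (y, t) (A (y, t), 1)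
        + u (y, t) * divg (spaceDeriv A (y, t))) (closure Ω) :=
      (hcDu.clm_apply (hcA.prodMk continuousOn_const)).add (hcu.mul ((hev _ _).add (hev _ _)))
    have heq : EqOn (fun y : Plane => fderiv ℝ u (y, t) (A (y, t), 1)
        + u (y, t) * divg (spaceDeriv A (y, t))) (fun _ => 0) Ω := fun y hy => by
      have hm : ((y, t) : Plane × ℝ) ∈ S := ⟨subset_closure hy, ht⟩
      have := conservation_form (hdiff ha _ hm) (hdiff hb _ hm) (hdiff hu _ hm)
      rw [hpde y hy t ht] at this
      exact this.symm
    exact heq.of_subset_closure hcont continuousOn_const subset_closure subset_rfl hx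

/-! ### Expansion of the feet of characteristics -/

/-- The linear part of the affine map that approximates the backward characteristics. -/
def stepLin (A : Plane × ℝ → Plane) (p : Plane × ℝ) (Δ : ℝ) : Plane →L[ℝ] Plane :=
  ContinuousLinearMap.id ℝ Plane - Δ • spaceDeriv A p

/-- The image of the base point under the affine map that approximates the backward
characteristics. -/
def stepBase (A : Plane × ℝ → Plane) (p : Plane × ℝ) (Δ : ℝ) : Plane :=
  p.1 - Δ • A p + (Δ ^ 2 / 2) • accel A p

lemma norm_prod_le_add (x : Plane) (r : ℝ) : ‖(x, r)‖ ≤ ‖x‖ + |r| :=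
  max_le (le_add_of_nonneg_right (abs_nonneg r)) (le_add_of_nonneg_left (norm_nonneg x))

/-- Along γ the velocity has derivative `accel`, which varies by O(Δ + h) from its value at (x₀, t),
so freezing it there and integrating twice costs O(Δ²(Δ + h)). Replacing the velocity at the
endpoint by its linearization at x₀ costs O(Δh²). Both are O(h³) when Δ = O(h). -/
lemma foot_expansion {Ω : Set Plane} {T C : ℝ} {a b u : Plane × ℝ → ℝ}
    (hD : DataBounds (closure Ω ×ˢ Icc 0 T) (velocity a b) u C) {s t h : ℝ} (hs : 0 ≤ s)
    (hst : s ≤ t) (ht : t ≤ T) {γ : ℝ → Plane} (hγ : IsCharacteristic Ω a b s t γ) {x₀ : Plane}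
    (hx₀ : x₀ ∈ closure Ω) (hh : ‖γ t - x₀‖ ≤ h) :
    ‖γ s - (stepBase (velocity a b) (x₀, t) (t - s)
      + stepLin (velocity a b) (x₀, t) (t - s) (γ t - x₀))‖
      ≤ C * ((C + 1) * (t - s) + h) * (t - s) ^ 2 + (t - s) * C * h ^ 2 := by
  set A := velocity a b with hA
  have hC0 : 0 ≤ C := zero_le_one.trans hD.one_le
  have hh0 : 0 ≤ h := (norm_nonneg _).trans hh
  have hΔ : 0 ≤ t - s := sub_nonneg.2 hst
  have hmem : ∀ τ ∈ Icc s t, (γ τ, τ) ∈ closure Ω ×ˢ Icc 0 T := fun τ hτ =>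
    ⟨(hγ τ hτ).1, hs.trans hτ.1, hτ.2.trans ht⟩
  have hmem0 : (x₀, t) ∈ closure Ω ×ˢ Icc 0 T := ⟨hx₀, hs.trans hst, ht⟩
  have htI : t ∈ Icc s t := ⟨hst, le_rfl⟩
  have hsI : s ∈ Icc s t := ⟨le_rfl, hst⟩
  have hdist : ∀ τ ∈ Icc s t, |τ - t| ≤ t - s := fun τ hτ => by
    rw [abs_le]; constructor <;> linarith [hτ.1, hτ.2]
  have hγ' : ∀ τ ∈ Icc s t, HasDerivWithinAt γ (A (γ τ, τ)) (Icc s t) τ := fun τ hτ => (hγ τ hτ).2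
  have h1 : ∀ τ ∈ Icc s t, ‖γ τ - γ t‖ ≤ C * (t - s) := fun τ hτ => by
    refine ((convex_Icc s t).norm_image_sub_le_of_norm_hasDerivWithin_le hγ'
      (fun y hy => hD.vel_le _ (hmem y hy)) htI hτ).trans ?_
    exact mul_le_mul_of_nonneg_left (hdist τ hτ) hC0
  set B := accel A (x₀, t) with hB
  set η := C * ((C + 1) * (t - s) + h) with hη
  have hη0 : 0 ≤ η := by positivity
  have hf : ∀ τ ∈ Icc s t, HasDerivWithinAt (fun τ => A (γ τ, τ)) (accel A (γ τ, τ)) (Icc s t) τ :=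
    fun τ hτ => HasFDerivAt.comp_hasDerivWithinAt τ (f := fun τ => (γ τ, τ))
      (hD.diff_vel _ (hmem τ hτ)).hasFDerivAt ((hγ' τ hτ).prodMk (hasDerivWithinAt_id τ _))
  have h2 : ∀ τ ∈ Icc s t, ‖accel A (γ τ, τ) - B‖ ≤ η := fun τ hτ => by
    refine (hD.accel_lip _ hmem0 _ (hmem τ hτ)).trans (mul_le_mul_of_nonneg_left ?_ hC0)
    refine (norm_prod_le_add _ _).trans ?_
    have e1 : ‖γ τ - x₀‖ ≤ ‖γ τ - γ t‖ + ‖γ t - x₀‖ := by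
      simpa using norm_add_le (γ τ - γ t) (γ t - x₀)
    have e2 := h1 τ hτ
    have e3 := hdist τ hτ
    simp only
    linarith
  have h3 : ∀ τ ∈ Icc s t, ‖A (γ τ, τ) - A (γ t, t) - (τ - t) • B‖ ≤ η * (t - s) := fun τ hτ => by
    have := (convex_Icc s t).norm_image_sub_le_of_norm_hasDerivWithin_le
      (f := fun τ => A (γ τ, τ) - τ • B) (f' := fun τ => accel A (γ τ, τ) - B) (C := η)
      (fun y hy => (hf y hy).sub (by simpa using (hasDerivWithinAt_id y _).smul_const B))
      h2 htI hτ
    refine le_trans (le_of_eq ?_) (this.trans (mul_le_mul_of_nonneg_left (hdist τ hτ) hη0))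
    congr 1
    rw [sub_smul]
    abel
  -- Second integration: the mean value inequality is applied to a function whose derivative was
  -- bounded in the preceding step.
  have h4 : ‖γ s - γ t + (t - s) • A (γ t, t) - ((t - s) ^ 2 / 2) • B‖
      ≤ η * (t - s) * (t - s) := by
    have := (convex_Icc s t).norm_image_sub_le_of_norm_hasDerivWithin_le
      (f := fun τ => γ τ - τ • A (γ t, t) - ((τ - t) ^ 2 / 2) • B)
      (f' := fun τ => A (γ τ, τ) - A (γ t, t) - (τ - t) • B) (C := η * (t - s))
      (fun y hy => ((hγ' y hy).sub
          (by simpa using (hasDerivWithinAt_id y _).smul_const (A (γ t, t)))).sub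
        (by
          have : HasDerivAt (fun τ : ℝ => (τ - t) ^ 2 / 2) (y - t) y := by
            have := (((hasDerivAt_id y).sub_const t).pow 2).div_const 2
            simpa using this
          exact this.hasDerivWithinAt.smul_const B))
      h3 htI hsI
    refine le_trans (le_of_eq ?_) (this.trans (mul_le_mul_of_nonneg_left (hdist s hsI)
      (by positivity)))
    congr 1
    rw [show (s - t) ^ 2 = (t - s) ^ 2 by ring]
    simp only [sub_self, sub_smul]
    simp
    abel
  have h5 : ‖A (γ t, t) - A (x₀, t) - spaceDeriv A (x₀, t) (γ t - x₀)‖ ≤ C * h ^ 2 := by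
    have := hD.vel_taylor _ hmem0 _ (hmem t htI)
    simp only [Prod.mk_sub_mk, sub_self] at this
    refine this.trans (mul_le_mul_of_nonneg_left ?_ hC0)
    refine pow_le_pow_left₀ (norm_nonneg _) ?_ 2
    exact (norm_prod_le_add _ _).trans (by simpa using hh)
  have h6 : γ s - (stepBase A (x₀, t) (t - s) + stepLin A (x₀, t) (t - s) (γ t - x₀))
      = (γ s - γ t + (t - s) • A (γ t, t) - ((t - s) ^ 2 / 2) • B)
        - (t - s) • (A (γ t, t) - A (x₀, t) - spaceDeriv A (x₀, t) (γ t - x₀)) := by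
    simp only [stepBase, stepLin, sub_apply, smul_apply,
      ContinuousLinearMap.id_apply, smul_sub, ← hB]
    abel
  rw [h6]
  refine (norm_sub_le _ _).trans ?_
  rw [norm_smul, Real.norm_of_nonneg hΔ]
  have := mul_le_mul_of_nonneg_left h5 hΔ
  nlinarith

/-! ### Geometry of the cells -/

lemma volume_real_ball (x : Plane) {r : ℝ} (hr : 0 ≤ r) :
    volume.real (Metric.ball x r) = r ^ 2 * volume.real (Metric.ball (0 : Plane) 1) := by
  simp only [Measure.real]
  rw [Measure.addHaar_ball volume x hr, ENNReal.toReal_mul, ENNReal.toReal_ofReal (by positivity)]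
  simp

lemma volume_real_closedBall (x : Plane) {r : ℝ} (hr : 0 ≤ r) :
    volume.real (Metric.closedBall x r) = r ^ 2 * volume.real (Metric.ball (0 : Plane) 1) := by
  simp only [Measure.real]
  rw [Measure.addHaar_closedBall volume x hr, ENNReal.toReal_mul,
    ENNReal.toReal_ofReal (by positivity)]
  simp

lemma volume_real_unitBall_pos : 0 < volume.real (Metric.ball (0 : Plane) 1) :=
  ENNReal.toReal_pos (Metric.measure_ball_pos volume _ one_pos).ne' measure_ball_lt_top.ne

namespace TriMesh

variable {J : ℕ} (M : TriMesh J)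

/-- The linear part of the affine parametrization of a cell over the reference triangle. -/
def cellLin (j : Fin J) : Plane →L[ℝ] Plane :=
  (EuclideanSpace.proj 0 : Plane →L[ℝ] ℝ).smulRight (M.vert j 1 - M.vert j 0)
    + (EuclideanSpace.proj 1 : Plane →L[ℝ] ℝ).smulRight (M.vert j 2 - M.vert j 0)

lemma cellLin_apply (j : Fin J) (ξ : Plane) :
    M.cellLin j ξ = ξ 0 • (M.vert j 1 - M.vert j 0) + ξ 1 • (M.vert j 2 - M.vert j 0) := by
  simp [cellLin]

lemma cell_eq_image (j : Fin J) :
    M.cell j = (fun ξ => M.vert j 0 + M.cellLin j ξ) '' refTri := by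
  apply Subset.antisymm
  · refine convexHull_min ?_ ?_
    · rintro _ ⟨i, rfl⟩
      fin_cases i
      · exact ⟨refNode 0, refNode_mem 0, by simp [cellLin_apply, refNode]⟩
      · exact ⟨refNode 1, refNode_mem 1, by simp [cellLin_apply, refNode]⟩
      · exact ⟨refNode 2, refNode_mem 2, by simp [cellLin_apply, refNode]⟩
    · have := (convex_refTri.linear_image (M.cellLin j).toLinearMap).translate (M.vert j 0)
      rw [image_image] at this
      exact this
  · rintro _ ⟨ξ, ⟨h0, h1, h2⟩, rfl⟩
    have := (convex_convexHull ℝ (range (M.vert j))).sum_mem (t := Finset.univ)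
      (w := ![1 - ξ 0 - ξ 1, ξ 0, ξ 1]) (z := M.vert j)
      (by intro i _; fin_cases i <;> simp <;> linarith) (by simp [Fin.sum_univ_three]; ring)
      (fun i _ => subset_convexHull ℝ _ (mem_range_self i))
    have heq : M.vert j 0 + M.cellLin j ξ = ∑ i, ![1 - ξ 0 - ξ 1, ξ 0, ξ 1] i • M.vert j i := by
      rw [cellLin_apply]
      simp only [Fin.sum_univ_three, Matrix.cons_val_zero, Matrix.cons_val_one, Matrix.cons_val]
      module
    rw [← heq] at this
    exact this

lemma isCompact_cell (j : Fin J) : IsCompact (M.cell j) := by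
  rw [cell_eq_image]
  exact isCompact_refTri.image (by fun_prop)

lemma convex_cell (j : Fin J) : Convex ℝ (M.cell j) := convex_convexHull ℝ _

lemma measurableSet_cell (j : Fin J) : MeasurableSet (M.cell j) :=
  (M.isCompact_cell j).isClosed.measurableSet

lemma node_eq (j : Fin J) (q : Fin 7) :
    M.node j q = M.vert j 0 + M.cellLin j (refNode q) := by
  fin_cases q <;> simp [node, cellLin_apply, refNode, midpoint_eq_smul_add] <;> module

lemma node_mem_cell (j : Fin J) (q : Fin 7) : M.node j q ∈ M.cell j := by
  rw [node_eq, cell_eq_image]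
  exact ⟨_, refNode_mem q, rfl⟩

lemma vert_mem_cell (j : Fin J) (i : Fin 3) : M.vert j i ∈ M.cell j :=
  subset_convexHull ℝ _ (mem_range_self i)

lemma diam_cell_le_size (j : Fin J) : Metric.diam (M.cell j) ≤ M.size :=
  le_ciSup (f := fun j => Metric.diam (M.cell j)) (finite_range _).bddAbove j

lemma norm_sub_le_size (j : Fin J) {x y : Plane} (hx : x ∈ M.cell j) (hy : y ∈ M.cell j) :
    ‖x - y‖ ≤ M.size := by
  rw [← dist_eq_norm]
  exact (Metric.dist_le_diam_of_mem (M.isCompact_cell j).isBounded hx hy).trans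
    (M.diam_cell_le_size j)

lemma size_pos (j : Fin J) : 0 < M.size := by
  have hne : M.vert j 0 ≠ M.vert j 1 := fun h => by
    simpa using (M.nondegenerate j).injective h
  have := M.norm_sub_le_size j (M.vert_mem_cell j 0) (M.vert_mem_cell j 1)
  exact (norm_pos_iff.2 (sub_ne_zero.2 hne)).trans_le this

lemma norm_cellLin_apply_le (j : Fin J) (ξ : Plane) : ‖M.cellLin j ξ‖ ≤ 2 * M.size * ‖ξ‖ := by
  have h1 := M.norm_sub_le_size j (M.vert_mem_cell j 1) (M.vert_mem_cell j 0)
  have h2 := M.norm_sub_le_size j (M.vert_mem_cell j 2) (M.vert_mem_cell j 0)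
  rw [cellLin_apply]
  refine (norm_add_le _ _).trans ?_
  rw [norm_smul, norm_smul]
  have e1 := mul_le_mul (abs_apply_le_norm ξ 0) h1 (norm_nonneg _) (norm_nonneg _)
  have e2 := mul_le_mul (abs_apply_le_norm ξ 1) h2 (norm_nonneg _) (norm_nonneg _)
  simp only [Real.norm_eq_abs]
  linarith

variable {M}

/-- Every vector of length at most σh is the difference of two points of the inscribed disc, hence
the image of a difference of two points of the reference triangle, which has norm at most 2. So the
inverse of `cellLin` has norm at most 2/(σh). -/
lemma IsQuasiUniform.le_norm_cellLin {σ : ℝ} (hσ : 0 < σ) (hM : M.IsQuasiUniform σ) (j : Fin J)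
    (ξ : Plane) : σ * M.size / 2 * ‖ξ‖ ≤ ‖M.cellLin j ξ‖ := by
  have hh := M.size_pos j
  obtain ⟨c, hc⟩ := hM j
  have hr : 0 < σ * M.size := by positivity
  have key : ∀ e : Plane, ‖e‖ ≤ 1 → ∃ ζ : Plane, ‖ζ‖ ≤ 2 ∧ M.cellLin j ζ = (σ * M.size) • e :=
    fun e he => by
    have m0 : c ∈ M.cell j := hc (Metric.mem_closedBall_self hr.le)
    have m1 : c + (σ * M.size) • e ∈ M.cell j := hc (by
      rw [mem_closedBall_iff_norm, add_sub_cancel_left, norm_smul, Real.norm_of_nonneg hr.le]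
      exact mul_le_of_le_one_right hr.le he)
    rw [cell_eq_image] at m0 m1
    obtain ⟨ξ₀, h₀, e₀⟩ := m0
    obtain ⟨ξ₁, h₁, e₁⟩ := m1
    refine ⟨ξ₁ - ξ₀, (norm_sub_le _ _).trans ?_, ?_⟩
    · linarith [norm_le_one_of_mem_refTri h₀, norm_le_one_of_mem_refTri h₁]
    · simp only at e₀ e₁
      rw [map_sub, ← add_sub_add_left_eq_sub _ _ (M.vert j 0), e₀, e₁, add_sub_cancel_left]
  have hsurj : Function.Surjective (M.cellLin j).toLinearMap := fun y => by
    rcases eq_or_ne y 0 with rfl | hy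
    · exact ⟨0, by simp⟩
    have hy' : 0 < ‖y‖ := norm_pos_iff.2 hy
    obtain ⟨ζ, -, hζ⟩ := key (‖y‖⁻¹ • y) (by rw [norm_smul]; simp [hy'.ne'])
    refine ⟨(‖y‖ / (σ * M.size)) • ζ, ?_⟩
    rw [ContinuousLinearMap.coe_coe, map_smul, hζ, smul_smul, smul_smul]
    field_simp
    simp
  have hinj : Function.Injective (M.cellLin j).toLinearMap :=
    LinearMap.injective_iff_surjective.2 hsurj
  rcases eq_or_ne (M.cellLin j ξ) 0 with h0 | h0
  · have : ξ = 0 := hinj (by simpa using h0)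
    simp [this]
  have hy' : 0 < ‖M.cellLin j ξ‖ := norm_pos_iff.2 h0
  obtain ⟨ζ, hζ2, hζ⟩ := key (‖M.cellLin j ξ‖⁻¹ • M.cellLin j ξ)
    (by rw [norm_smul]; simp [hy'.ne'])
  -- By injectivity the preimage of the vector of length σh in the direction of the image of ξ is a
  -- multiple of ξ, so its bound is a bound for ξ.
  have hζξ : ζ = (σ * M.size / ‖M.cellLin j ξ‖) • ξ := hinj (by
    rw [ContinuousLinearMap.coe_coe, map_smul, hζ, smul_smul]
    rfl)
  rw [hζξ, norm_smul, Real.norm_of_nonneg (by positivity), div_mul_eq_mul_div,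
    div_le_iff₀ hy'] at hζ2
  linarith

lemma IsQuasiUniform.cellLin_injective {σ : ℝ} (hσ : 0 < σ) (hM : M.IsQuasiUniform σ)
    (j : Fin J) : Function.Injective (M.cellLin j) :=
  (injective_iff_map_eq_zero _).2 fun ξ hξ => by
    have h1 := hM.le_norm_cellLin hσ j ξ
    rw [hξ, norm_zero] at h1
    have h2 : 0 < σ * M.size / 2 := by have := M.size_pos j; positivity
    exact norm_eq_zero.1 (le_antisymm (by nlinarith) (norm_nonneg ξ))

lemma IsQuasiUniform.interior_nonempty {σ : ℝ} (hσ : 0 < σ) (hM : M.IsQuasiUniform σ)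
    (j : Fin J) : (interior (M.cell j)).Nonempty := by
  obtain ⟨c, hc⟩ := hM j
  have hr : 0 < σ * M.size := mul_pos hσ (M.size_pos j)
  exact ⟨c, interior_mono hc (Metric.ball_subset_interior_closedBall (Metric.mem_ball_self hr))⟩

lemma volume_real_cell_le (j : Fin J) :
    volume.real (M.cell j) ≤ M.size ^ 2 * volume.real (Metric.ball (0 : Plane) 1) := by
  rw [← volume_real_closedBall (M.vert j 0) (M.size_pos j).le]
  refine measureReal_mono (fun x hx => ?_) measure_closedBall_lt_top.ne
  exact mem_closedBall_iff_norm.2 (M.norm_sub_le_size j hx (M.vert_mem_cell j 0))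

lemma IsQuasiUniform.le_volume_real_cell {σ : ℝ} (hσ : 0 < σ) (hM : M.IsQuasiUniform σ)
    (j : Fin J) :
    (σ * M.size) ^ 2 * volume.real (Metric.ball (0 : Plane) 1) ≤ volume.real (M.cell j) := by
  obtain ⟨c, hc⟩ := hM j
  rw [← volume_real_closedBall c (mul_pos hσ (M.size_pos j)).le]
  exact measureReal_mono hc (M.isCompact_cell j).measure_lt_top.ne

/-- Only boundedly many cells meet a ball whose radius is comparable to the mesh size. -/
lemma IsQuasiUniform.card_le {σ : ℝ} (hσ : 0 < σ) (hM : M.IsQuasiUniform σ) {r : ℝ} (hr : 0 ≤ r)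
    (x : Plane) (s : Finset (Fin J))
    (hs : ∀ l ∈ s, (M.cell l ∩ Metric.closedBall x (r * M.size)).Nonempty) :
    (s.card : ℝ) ≤ ((r + 1) / σ) ^ 2 := by
  rcases s.eq_empty_or_nonempty with rfl | ⟨l₀, -⟩
  · simpa using sq_nonneg _
  have hh := M.size_pos l₀
  choose c hc using hM
  have hball : ∀ l, Metric.ball (c l) (σ * M.size) ⊆ interior (M.cell l) := fun l =>
    interior_maximal (Metric.ball_subset_closedBall.trans (hc l)) Metric.isOpen_ball
  -- Area comparison: the inscribed discs are disjoint and all lie in a disc of radius (r + 1)h.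
  have hdisj : Pairwise fun l k => Disjoint (Metric.ball (c l) (σ * M.size))
      (Metric.ball (c k) (σ * M.size)) := fun l k hlk =>
    (M.nonoverlapping hlk).mono (hball l) (hball k)
  have hsub : (⋃ l ∈ s, Metric.ball (c l) (σ * M.size))
      ⊆ Metric.closedBall x ((r + 1) * M.size) := by
    refine iUnion₂_subset fun l hl y hy => ?_
    obtain ⟨z, hz, hzx⟩ := hs l hl
    have h1 := M.norm_sub_le_size l (interior_subset (hball l hy)) hz
    rw [← dist_eq_norm] at h1
    have h2 := Metric.mem_closedBall.1 hzx
    rw [Metric.mem_closedBall]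
    linarith [dist_triangle y z x]
  have h1 := measureReal_mono (μ := volume) hsub measure_closedBall_lt_top.ne
  rw [measureReal_biUnion_finset (fun l _ k _ hlk => hdisj hlk) (fun l _ => measurableSet_ball),
    volume_real_closedBall _ (by positivity)] at h1
  simp only [volume_real_ball _ (mul_pos hσ hh).le, Finset.sum_const, nsmul_eq_mul] at h1
  have hV := volume_real_unitBall_pos
  rw [← mul_assoc] at h1
  have h2 := le_of_mul_le_mul_right h1 hV
  rw [div_pow, le_div_iff₀ (by positivity)]
  have h3 : (s.card * σ ^ 2) * M.size ^ 2 ≤ (r + 1) ^ 2 * M.size ^ 2 := by nlinarith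
  exact le_of_mul_le_mul_right h3 (by positivity)

end TriMesh

/-! ### Existence and uniqueness of the update -/

/-- Serves both linear problems of the scheme: the least-squares fit, with the Gram form of the
traced nodes, and the update, with the mass form of the cell. -/
lemma bijective_of_definite {V : Type*} [AddCommGroup V] [Module ℝ V] [Module.Finite ℝ V]
    (B : V →ₗ[ℝ] Module.Dual ℝ V) (hB : ∀ v, B v v = 0 → v = 0) : Function.Bijective B := by
  have hinj : Function.Injective B := (injective_iff_map_eq_zero B).2 fun v hv => hB v (by simp [hv])
  exact ⟨hinj, (LinearMap.injective_iff_surjective_of_finrank_eq_finrank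
    Subspace.dual_finrank_eq.symm).1 hinj⟩

section Fit

variable {J : ℕ} (M : TriMesh J) (Φ : Plane → Plane) (j : Fin J)

/-- The normal equations of the least-squares problem. -/
lemma isLeastSquaresFit_iff (Ψ ψ : Poly 2) : IsLeastSquaresFit M Φ j Ψ ψ ↔
    ∀ χ : Poly 2, ∑ q, pval ψ (Φ (M.node j q)) * pval χ (Φ (M.node j q))
      = ∑ q, pval Ψ (M.node j q) * pval χ (Φ (M.node j q)) := by
  have expand : ∀ (χ : Poly 2) (r : ℝ),
      ∑ q, (pval (ψ + r • χ) (Φ (M.node j q)) - pval Ψ (M.node j q)) ^ 2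
      = ∑ q, (pval ψ (Φ (M.node j q)) - pval Ψ (M.node j q)) ^ 2
        + 2 * r * (∑ q, pval ψ (Φ (M.node j q)) * pval χ (Φ (M.node j q))
          - ∑ q, pval Ψ (M.node j q) * pval χ (Φ (M.node j q)))
        + r ^ 2 * ∑ q, pval χ (Φ (M.node j q)) ^ 2 := fun χ r => by
    rw [← Finset.sum_sub_distrib, Finset.mul_sum, Finset.mul_sum, ← Finset.sum_add_distrib,
      ← Finset.sum_add_distrib]
    refine Finset.sum_congr rfl fun q _ => ?_
    rw [pval_add, pval_smul]
    ring
  constructor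
  · intro h χ
    set X := ∑ q, pval ψ (Φ (M.node j q)) * pval χ (Φ (M.node j q))
          - ∑ q, pval Ψ (M.node j q) * pval χ (Φ (M.node j q)) with hX
    set Y := ∑ q, pval χ (Φ (M.node j q)) ^ 2 with hY
    have hY0 : 0 ≤ Y := Finset.sum_nonneg fun q _ => sq_nonneg _
    have key : ∀ r : ℝ, 0 ≤ 2 * r * X + r ^ 2 * Y := fun r => by
      have := h (ψ + r • χ)
      rw [expand] at this
      linarith
    -- The shift by 1 avoids a separate case Y = 0; with this r the quadratic is still negative
    -- unless X = 0.
    have h1 := key (-X / (Y + 1))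
    have h2 : 2 * (-X / (Y + 1)) * X + (-X / (Y + 1)) ^ 2 * Y
        = -(X ^ 2 * (Y + 2)) / (Y + 1) ^ 2 := by
      field_simp
      ring
    rw [h2, le_div_iff₀ (by positivity), zero_mul] at h1
    have h3 : X = 0 := by
      by_contra hne
      have : 0 < X ^ 2 * (Y + 2) := by positivity
      linarith
    exact sub_eq_zero.1 h3
  · intro h χ
    have := expand (χ - ψ) 1
    rw [one_smul, add_sub_cancel, h (χ - ψ), sub_self] at this
    rw [this]
    have : 0 ≤ ∑ q, pval (χ - ψ) (Φ (M.node j q)) ^ 2 := Finset.sum_nonneg fun q _ => sq_nonneg _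
    linarith

/-- Unisolvence makes the Gram form definite, so the normal equations have exactly one solution. Its
linearity in Ψ makes the right-hand side of the scheme a linear functional of Ψ. -/
lemma exists_fit_linear (huni : ∀ ψ : Poly 2, (∀ q, pval ψ (Φ (M.node j q)) = 0) → ψ = 0) :
    ∃ S : Poly 2 →ₗ[ℝ] Poly 2, ∀ Ψ ψ, IsLeastSquaresFit M Φ j Ψ ψ ↔ ψ = S Ψ := by
  let B : Poly 2 →ₗ[ℝ] Module.Dual ℝ (Poly 2) :=
    LinearMap.mk₂ ℝ (fun ψ χ => ∑ q, pval ψ (Φ (M.node j q)) * pval χ (Φ (M.node j q)))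
      (fun p q χ => by simp [add_mul, Finset.sum_add_distrib])
      (fun r p χ => by simp [mul_assoc, Finset.mul_sum])
      (fun p q χ => by simp [mul_add, Finset.sum_add_distrib])
      (fun r p χ => by simp [mul_left_comm, Finset.mul_sum])
  let R : Poly 2 →ₗ[ℝ] Module.Dual ℝ (Poly 2) :=
    LinearMap.mk₂ ℝ (fun Ψ χ => ∑ q, pval Ψ (M.node j q) * pval χ (Φ (M.node j q)))
      (fun p q χ => by simp [add_mul, Finset.sum_add_distrib])
      (fun r p χ => by simp [mul_assoc, Finset.mul_sum])
      (fun p q χ => by simp [mul_add, Finset.sum_add_distrib])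
      (fun r p χ => by simp [mul_left_comm, Finset.mul_sum])
  have hB : Function.Bijective B := bijective_of_definite B fun ψ hψ => huni ψ fun q => by
    have hψ' : ∑ q, pval ψ (Φ (M.node j q)) * pval ψ (Φ (M.node j q)) = 0 := hψ
    have := (Finset.sum_eq_zero_iff_of_nonneg fun q _ => mul_self_nonneg _).1 hψ' q
      (Finset.mem_univ q)
    simpa using this
  let e := LinearEquiv.ofBijective B hB
  refine ⟨e.symm.toLinearMap ∘ₗ R, fun Ψ ψ => ?_⟩
  rw [isLeastSquaresFit_iff, LinearMap.comp_apply, LinearEquiv.coe_coe, LinearEquiv.eq_symm_apply]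
  exact ⟨fun h => LinearMap.ext h, fun h χ => LinearMap.congr_fun h χ⟩

variable {M}

/-- The update exists and is unique as soon as the traced nodes determine quadratic polynomials. -/
lemma exists_update {σ : ℝ} (hσ : 0 < σ) (hM : M.IsQuasiUniform σ)
    (huni : ∀ ψ : Poly 2, (∀ q, pval ψ (Φ (M.node j q)) = 0) → ψ = 0) (uOld : M.DGSpace 2) :
    ∃ p : Poly 2, ∀ p', IsUpdate M Φ uOld j p' ↔ p' = p := by
  obtain ⟨S, hS⟩ := exists_fit_linear M Φ j huni
  have hint : ∀ (D : Set Plane) (l : Fin J) (p q : Poly 2),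
      IntegrableOn (fun x => pval p x * pval q x) (D ∩ M.cell l) := fun D l p q =>
    (((continuous_pval p).mul (continuous_pval q)).continuousOn.integrableOn_compact
      (M.isCompact_cell l)).mono_set inter_subset_right
  have hint' : ∀ p q : Poly 2, IntegrableOn (fun x => pval p x * pval q x) (M.cell j) := fun p q =>
    ((continuous_pval p).mul (continuous_pval q)).continuousOn.integrableOn_compact
      (M.isCompact_cell j)
  let B : Poly 2 →ₗ[ℝ] Module.Dual ℝ (Poly 2) :=
    LinearMap.mk₂ ℝ (fun p Ψ => ∫ x in M.cell j, pval p x * pval Ψ x)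
      (fun p q χ => by
        simp only [pval_add, add_mul]
        exact integral_add (hint' p χ) (hint' q χ))
      (fun r p χ => by
        simp only [pval_smul, mul_assoc]
        exact integral_const_mul _ _)
      (fun p q χ => by
        simp only [pval_add, mul_add]
        exact integral_add (hint' p q) (hint' p χ))
      (fun r p χ => by
        simp only [pval_smul, mul_left_comm]
        exact integral_const_mul _ _)
  let ℓ : Module.Dual ℝ (Poly 2) :=
    { toFun := fun ψ => remapIntegral M (upstream M Φ j) uOld ψ
      map_add' := fun p q => by
        simp only [remapIntegral, pval_add, mul_add, ← Finset.sum_add_distrib]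
        exact Finset.sum_congr rfl fun l _ => integral_add (hint _ l _ p) (hint _ l _ q)
      map_smul' := fun r p => by
        simp only [remapIntegral, pval_smul, mul_left_comm _ r, Finset.mul_sum, smul_eq_mul,
          RingHom.id_apply]
        exact Finset.sum_congr rfl fun l _ => integral_const_mul _ _ }
  -- Zero L² norm on the cell forces the nodal values to vanish, and these determine p everywhere.
  have hB : Function.Bijective B := bijective_of_definite B fun p hp => by
    have h0 := eq_zero_of_setIntegral_sq_eq_zero (M.isCompact_cell j) (M.convex_cell j)
      (hM.interior_nonempty hσ j) (continuous_pval p) hp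
    have hq : IsQuad fun ξ => pval p (M.vert j 0 + M.cellLin j ξ) :=
      (isQuad_pval p).comp_affine _ _
    have hzero : ∀ ξ, pval p (M.vert j 0 + M.cellLin j ξ) = 0 := fun ξ => by
      rw [hq.eq_sum_shapeFun ξ]
      refine Finset.sum_eq_zero fun i _ => ?_
      rw [← M.node_eq, h0 _ (M.node_mem_cell j _), mul_zero]
    have hinj : Function.Injective (M.cellLin j).toLinearMap := hM.cellLin_injective hσ j
    refine pval_injective fun x => ?_
    obtain ⟨ξ, hξ⟩ := LinearMap.injective_iff_surjective.1 hinj (x - M.vert j 0)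
    have := hzero ξ
    rw [show M.cellLin j ξ = x - M.vert j 0 from hξ, add_sub_cancel] at this
    rw [this, pval_zero]
  let e := LinearEquiv.ofBijective B hB
  refine ⟨e.symm (ℓ ∘ₗ S), fun p' => ?_⟩
  rw [LinearEquiv.eq_symm_apply]
  constructor
  · exact fun h => LinearMap.ext fun Ψ => h Ψ (S Ψ) ((hS Ψ _).2 rfl)
  · intro h Ψ ψ hψ
    rw [(hS Ψ ψ).1 hψ]
    exact LinearMap.congr_fun h Ψ

end Fit

/-! ### Determinants of small perturbations of the identity -/

lemma det_plane (f : Plane →L[ℝ] Plane) :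
    f.det = f (EuclideanSpace.single 0 1) 0 * f (EuclideanSpace.single 1 1) 1
      - f (EuclideanSpace.single 1 1) 0 * f (EuclideanSpace.single 0 1) 1 := by
  have h : f.det = LinearMap.det (f : Plane →ₗ[ℝ] Plane) := rfl
  rw [h, ← LinearMap.det_toMatrix (EuclideanSpace.basisFun (Fin 2) ℝ).toBasis, Matrix.det_fin_two]
  simp [LinearMap.toMatrix_apply]

lemma abs_apply_single_le {P : Plane →L[ℝ] Plane} {δ : ℝ} (hP : ‖P‖ ≤ δ) (i k : Fin 2) :
    |P (EuclideanSpace.single i 1) k| ≤ δ := by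
  refine (abs_apply_le_norm _ k).trans ((P.le_opNorm _).trans ?_)
  simpa using hP

lemma abs_divg_le {P : Plane →L[ℝ] Plane} {δ : ℝ} (hP : ‖P‖ ≤ δ) : |divg P| ≤ 2 * δ := by
  refine (abs_add_le _ _).trans ?_
  linarith [abs_apply_single_le hP 0 0, abs_apply_single_le hP 1 1]

/-- In dimension two det(I + P) = 1 + tr P + det P exactly, so the remainder is det P. -/
lemma abs_det_id_add_sub_le {P : Plane →L[ℝ] Plane} {δ : ℝ} (hP : ‖P‖ ≤ δ) :
    |(ContinuousLinearMap.id ℝ Plane + P).det - (1 + divg P)| ≤ 2 * δ ^ 2 := by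
  have hδ : 0 ≤ δ := (norm_nonneg _).trans hP
  have h00 := abs_apply_single_le hP 0 0
  have h01 := abs_apply_single_le hP 0 1
  have h10 := abs_apply_single_le hP 1 0
  have h11 := abs_apply_single_le hP 1 1
  have heq : (ContinuousLinearMap.id ℝ Plane + P).det - (1 + divg P)
      = P (EuclideanSpace.single 0 1) 0 * P (EuclideanSpace.single 1 1) 1
        - P (EuclideanSpace.single 1 1) 0 * P (EuclideanSpace.single 0 1) 1 := by
    rw [det_plane]
    simp [divg]
    ring
  rw [heq]
  refine (abs_sub _ _).trans ?_
  rw [abs_mul, abs_mul]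
  have e1 := mul_le_mul h00 h11 (abs_nonneg _) hδ
  have e2 := mul_le_mul h10 h01 (abs_nonneg _) hδ
  linarith

lemma exists_inverse {H : Plane →L[ℝ] Plane} (hH : Function.Injective H) :
    ∃ K : Plane →L[ℝ] Plane, (∀ x, K (H x) = x) ∧ ∀ x, H (K x) = x := by
  let e := LinearEquiv.ofInjectiveEndo H.toLinearMap hH
  exact ⟨LinearMap.toContinuousLinearMap e.symm.toLinearMap, fun x => e.symm_apply_apply x,
    fun x => e.apply_symm_apply x⟩

lemma setIntegral_cell {J : ℕ} (M : TriMesh J) (j : Fin J) (hinj : Function.Injective (M.cellLin j))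
    (f : Plane → ℝ) :
    ∫ x in M.cell j, f x
      = |(M.cellLin j).det| * ∫ ξ in refTri, f (M.vert j 0 + M.cellLin j ξ) := by
  rw [M.cell_eq_image, integral_image_eq_integral_abs_det_fderiv_smul volume
    isClosed_refTri.measurableSet (f := fun ξ => M.vert j 0 + M.cellLin j ξ)
    (f' := fun _ => M.cellLin j)
    (fun ξ _ => ((M.cellLin j).hasFDerivAt.const_add _).hasFDerivWithinAt)
    (fun ξ _ ζ _ h => hinj (add_left_cancel h)), ← integral_const_mul]
  rfl

lemma volume_real_cell {J : ℕ} (M : TriMesh J) (j : Fin J)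
    (hinj : Function.Injective (M.cellLin j)) :
    volume.real (M.cell j) = |(M.cellLin j).det| * volume.real refTri := by
  simpa using setIntegral_cell M j hinj (fun _ => 1)

/-! ### The traced element -/

/-- The traced nodes of the `j`-th cell are the images under the affine map `w + H ξ` of slightly
displaced reference nodes. -/
structure Traced {J : ℕ} (M : TriMesh J) (Φ : Plane → Plane) (j : Fin J) (w : Plane)
    (H : Plane →L[ℝ] Plane) (ρ : Fin 7 → Plane) (ε : ℝ) : Prop where
  inj : Function.Injective H
  node : ∀ q, Φ (M.node j q) = w + H (refNode q + ρ q)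
  small : ∀ q, ‖ρ q‖ ≤ ε
  eps_le : 2400 * ε ≤ 1

namespace Traced

variable {J : ℕ} {M : TriMesh J} {Φ : Plane → Plane} {j : Fin J} {w : Plane}
  {H : Plane →L[ℝ] Plane} {ρ : Fin 7 → Plane} {ε : ℝ}

lemma eps_nonneg (h : Traced M Φ j w H ρ ε) : 0 ≤ ε := (norm_nonneg _).trans (h.small 0)

/-- The shape functions sum to 1 and reproduce linear functions, so the isoparametric interpolation
commutes with affine maps. -/
lemma isoMap_eq (h : Traced M Φ j w H ρ ε) (ξ : Plane) :
    isoMap (fun i : Fin 6 => Φ (M.node j i.castSucc)) (ξ 0, ξ 1) = w + H (perturb ρ ξ) := by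
  have h1 : isoMap (fun i : Fin 6 => Φ (M.node j i.castSucc)) (ξ 0, ξ 1)
      = ∑ i, shapeFun i ξ • (w + H (refNode (Fin.castSucc i) + ρ (Fin.castSucc i))) := by
    simp only [isoMap, h.node, shapeFun]
  rw [h1]
  simp only [smul_add, Finset.sum_add_distrib, ← Finset.sum_smul, sum_shapeFun, one_smul, map_add,
    ← map_smul, ← map_sum, perturb, sum_shapeFun_smul_refNode]

lemma upstream_eq (h : Traced M Φ j w H ρ ε) :
    upstream M Φ j = (fun ξ => w + H (perturb ρ ξ)) '' refTri := by
  apply Subset.antisymm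
  · rintro _ ⟨⟨x, y⟩, hξ, rfl⟩
    exact ⟨!₂[x, y], by simpa [refTri, refTriangle] using hξ, by
      simpa using (h.isoMap_eq !₂[x, y]).symm⟩
  · rintro _ ⟨ξ, hξ, rfl⟩
    exact ⟨(ξ 0, ξ 1), hξ, h.isoMap_eq ξ⟩

lemma isCompact_upstream (h : Traced M Φ j w H ρ ε) : IsCompact (upstream M Φ j) := by
  rw [h.upstream_eq]
  refine isCompact_refTri.image (continuous_const.add (H.continuous.comp ?_))
  exact continuous_iff_continuousAt.2 fun ξ => (hasFDerivAt_perturb ρ ξ).continuousAt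

lemma setIntegral_upstream (h : Traced M Φ j w H ρ ε) (f : Plane → ℝ) :
    ∫ x in upstream M Φ j, f x = ∫ ξ in refTri,
      |H.det| * |(ContinuousLinearMap.id ℝ Plane + perturbDeriv ρ ξ).det|
        * f (w + H (perturb ρ ξ)) := by
  rw [h.upstream_eq, integral_image_eq_integral_abs_det_fderiv_smul volume
    isClosed_refTri.measurableSet (f := fun ξ => w + H (perturb ρ ξ))
    (f' := fun ξ => H.comp (ContinuousLinearMap.id ℝ Plane + perturbDeriv ρ ξ))
    (fun ξ _ => ((H.hasFDerivAt.comp ξ (hasFDerivAt_perturb ρ ξ)).const_add _).hasFDerivWithinAt)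
    (fun ξ hξ ζ hζ hh => perturb_injOn h.small (by linarith [h.eps_nonneg, h.eps_le]) hξ hζ
      (h.inj (add_left_cancel hh)))]
  refine integral_congr_ae (Filter.Eventually.of_forall fun ξ => ?_)
  have : (H.comp (ContinuousLinearMap.id ℝ Plane + perturbDeriv ρ ξ)).det
      = H.det * (ContinuousLinearMap.id ℝ Plane + perturbDeriv ρ ξ).det :=
    LinearMap.det_comp _ _
  simp only [this, abs_mul, smul_eq_mul]

lemma norm_perturb_le (h : Traced M Φ j w H ρ ε) {ξ : Plane} (hξ : ξ ∈ refTri) :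
    ‖perturb ρ ξ‖ ≤ 2 := by
  have h1 := norm_le_one_of_mem_refTri hξ
  have h2 := norm_perturb_sub_le h.small (ξ := ξ) (by linarith)
  have h3 : ‖perturb ρ ξ‖ ≤ ‖perturb ρ ξ - ξ‖ + ‖ξ‖ := by
    simpa using norm_add_le (perturb ρ ξ - ξ) ξ
  linarith [h.eps_le]

/-- Minimality of ψ is used only against one competitor χ: the quadratic that transports Ψ by the
affine map from the cell to its approximate upstream image. In reference coordinates this is the
comparison in `nodalNorm_fit_sub_le`. -/
lemma fit_estimate (h : Traced M Φ j w H ρ ε) {Ψ ψ : Poly 2}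
    (hfit : IsLeastSquaresFit M Φ j Ψ ψ) :
    nodalNorm (fun ξ => pval ψ (w + H ξ) - pval Ψ (M.vert j 0 + M.cellLin j ξ))
      ≤ 4800 * ε * nodalNorm (fun ξ => pval Ψ (M.vert j 0 + M.cellLin j ξ)) := by
  obtain ⟨K, hKH, -⟩ := exists_inverse h.inj
  have hΨ : IsQuad fun ξ => pval Ψ (M.vert j 0 + M.cellLin j ξ) := (isQuad_pval Ψ).comp_affine _ _
  obtain ⟨χ, hχ⟩ := (hΨ.comp_affine (-K w) K).exists_pval_eq
  have hχ' : ∀ ξ, pval χ (w + H ξ) = pval Ψ (M.vert j 0 + M.cellLin j ξ) := fun ξ => by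
    rw [hχ]
    simp only [map_add, hKH, neg_add_cancel_left]
  refine nodalNorm_fit_sub_le h.small (by linarith [h.eps_nonneg, h.eps_le])
    ((isQuad_pval ψ).comp_affine w H) hΨ ?_
  have := hfit χ
  simp only [h.node, hχ'] at this
  simpa only [M.node_eq] using this

/-- A quadratic vanishing at the traced nodes is a least-squares fit to zero data, so the fit
estimate forces it to vanish. -/
lemma unisolvent (h : Traced M Φ j w H ρ ε) {ψ : Poly 2}
    (h0 : ∀ q, pval ψ (Φ (M.node j q)) = 0) : ψ = 0 := by
  have hfit : IsLeastSquaresFit M Φ j 0 ψ := fun χ => by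
    simp only [h0, pval_zero, sub_zero]
    simpa using Finset.sum_nonneg fun q _ => sq_nonneg _
  have h1 := h.fit_estimate hfit
  have hn0 : nodalNorm (fun _ : Plane => (0 : ℝ)) = 0 := by
    simp [nodalNorm, ← Pi.zero_def]
  simp only [pval_zero, sub_zero, hn0, mul_zero] at h1
  obtain ⟨K, -, hHK⟩ := exists_inverse h.inj
  have hq : IsQuad fun ξ => pval ψ (w + H ξ) := (isQuad_pval ψ).comp_affine w H
  refine pval_injective fun x => ?_
  have h2 : pval ψ (w + H (K (x - w))) = 0 := by
    have := hq.eq_sum_shapeFun (K (x - w))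
    rw [this]
    refine Finset.sum_eq_zero fun i _ => ?_
    have := abs_le_nodalNorm (fun ξ => pval ψ (w + H ξ)) i
    rw [abs_nonpos_iff.1 (this.trans h1), mul_zero]
  rw [hHK, add_sub_cancel] at h2
  rw [h2, pval_zero]

end Traced

/-! ### The affine approximation of the backward characteristics -/

section Step

variable {S : Set (Plane × ℝ)} {A : Plane × ℝ → Plane} {u : Plane × ℝ → ℝ} {C : ℝ}

lemma DataBounds.norm_spaceDeriv_le (hD : DataBounds S A u C) {p : Plane × ℝ} (hp : p ∈ S) :
    ‖spaceDeriv A p‖ ≤ C := by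
  have hC0 : 0 ≤ C := zero_le_one.trans hD.one_le
  refine ContinuousLinearMap.opNorm_le_bound _ hC0 fun y => ?_
  refine ((fderiv ℝ A p).le_opNorm _).trans ?_
  refine mul_le_mul (hD.dvel_le p hp) ?_ (norm_nonneg _) hC0
  exact (norm_prod_le_add _ _).trans (by simp)

lemma DataBounds.norm_stepLin_ge (hD : DataBounds S A u C) {p : Plane × ℝ} (hp : p ∈ S) {Δ : ℝ}
    (hΔ : 0 ≤ Δ) (hΔC : 2 * (Δ * C) ≤ 1) (y : Plane) : ‖y‖ / 2 ≤ ‖stepLin A p Δ y‖ := by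
  have h1 : ‖Δ • spaceDeriv A p y‖ ≤ 1 / 2 * ‖y‖ := by
    rw [norm_smul, Real.norm_of_nonneg hΔ]
    have := (spaceDeriv A p).le_of_opNorm_le (hD.norm_spaceDeriv_le hp) y
    calc Δ * ‖spaceDeriv A p y‖ ≤ Δ * (C * ‖y‖) := mul_le_mul_of_nonneg_left this hΔ
      _ = Δ * C * ‖y‖ := by ring
      _ ≤ 1 / 2 * ‖y‖ := mul_le_mul_of_nonneg_right (by linarith) (norm_nonneg y)
  have h2 : ‖y‖ - ‖Δ • spaceDeriv A p y‖ ≤ ‖stepLin A p Δ y‖ := norm_sub_norm_le _ _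
  linarith

end Step

/-- Tracing that is third-order accurate at the nodes displaces the reference nodes by `O(h²)`. -/
lemma exists_traced {Ω : Set Plane} {T C : ℝ} {a b u : Plane × ℝ → ℝ}
    (hD : DataBounds (closure Ω ×ˢ Icc 0 T) (velocity a b) u C) {σ c κ : ℝ} (hσ : 0 < σ)
    (hc : 0 ≤ c) {J : ℕ} {M : TriMesh J} {s t : ℝ} {Φ : Plane → Plane} {j : Fin J}
    (hreg : M.region ⊆ closure Ω) (hM : M.IsQuasiUniform σ) (hs : 0 ≤ s) (hst : s ≤ t) (ht : t ≤ T)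
    (hΔ : t - s ≤ c * M.size) (hΔC : 2 * (c * C) * M.size ≤ 1)
    (htr : TracingAccurate M Ω a b s t κ Φ)
    (hin : UpstreamInside M Ω a b s t Φ j)
    (hε : 2400 * (4 / σ * (C * ((C + 1) * c + 1) * c ^ 2 + c * C + |κ| * c ^ 3) * M.size ^ 2) ≤ 1) :
    ∃ ρ, Traced M Φ j (stepBase (velocity a b) (M.vert j 0, t) (t - s))
      ((stepLin (velocity a b) (M.vert j 0, t) (t - s)).comp (M.cellLin j)) ρ
      (4 / σ * (C * ((C + 1) * c + 1) * c ^ 2 + c * C + |κ| * c ^ 3) * M.size ^ 2) := by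
  set A := velocity a b with hA
  set x₀ := M.vert j 0 with hx₀
  set h := M.size with hh
  set w := stepBase A (x₀, t) (t - s) with hw
  set H := (stepLin A (x₀, t) (t - s)).comp (M.cellLin j) with hH
  set C₁ := C * ((C + 1) * c + 1) * c ^ 2 + c * C + |κ| * c ^ 3 with hC₁
  have hpos : 0 < h := M.size_pos j
  have hC0 : 0 ≤ C := zero_le_one.trans hD.one_le
  have hΔ0 : 0 ≤ t - s := sub_nonneg.2 hst
  have hcell : M.cell j ⊆ closure Ω := (subset_iUnion M.cell j).trans hreg
  have hx₀Ω : x₀ ∈ closure Ω := hcell (M.vert_mem_cell j 0)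
  have hp₀ : (x₀, t) ∈ closure Ω ×ˢ Icc 0 T := ⟨hx₀Ω, hs.trans hst, ht⟩
  have hΔC' : 2 * ((t - s) * C) ≤ 1 := by
    have := mul_le_mul_of_nonneg_right hΔ hC0
    nlinarith
  -- A factor σh/2 comes from the cell map and 1/2 from the time step.
  have hlow : ∀ ξ, σ * h / 4 * ‖ξ‖ ≤ ‖H ξ‖ := fun ξ => by
    have e1 := hM.le_norm_cellLin hσ j ξ
    have e2 := hD.norm_stepLin_ge hp₀ hΔ0 hΔC' (M.cellLin j ξ)
    have e3 : ‖H ξ‖ = ‖stepLin A (x₀, t) (t - s) (M.cellLin j ξ)‖ := rfl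
    linarith
  have hm : 0 < σ * h / 4 := by positivity
  have hinj : Function.Injective H := (injective_iff_map_eq_zero _).2 fun ξ hξ => by
    have := hlow ξ
    rw [hξ, norm_zero] at this
    exact norm_eq_zero.1 (le_antisymm (by nlinarith) (norm_nonneg ξ))
  obtain ⟨K, -, hHK⟩ := exists_inverse hinj
  have herr : ∀ q, ‖Φ (M.node j q) - (w + H (refNode q))‖ ≤ C₁ * h ^ 3 := fun q => by
    have hnode := M.node_mem_cell j q
    obtain ⟨y, hy⟩ := hin.1 _ hnode
    have h1 := htr j q y hy
    obtain ⟨γ, hγ, hγt, hγs⟩ := hy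
    have hd : ‖γ t - x₀‖ ≤ h := by
      rw [hγt]
      exact M.norm_sub_le_size j hnode (M.vert_mem_cell j 0)
    have h2 := foot_expansion hD hs hst ht hγ hx₀Ω hd
    have h3 : γ t - x₀ = M.cellLin j (refNode q) := by
      rw [hγt, M.node_eq, add_sub_cancel_left]
    rw [h3, hγs] at h2
    have h4 : ‖Φ (M.node j q) - (w + H (refNode q))‖
        ≤ dist (Φ (M.node j q)) y + ‖y - (w + H (refNode q))‖ := by
      rw [dist_eq_norm]
      simpa using norm_add_le (Φ (M.node j q) - y) (y - (w + H (refNode q)))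
    have h5 : κ * (t - s) ^ 3 ≤ |κ| * (c * h) ^ 3 := by
      have := pow_le_pow_left₀ hΔ0 hΔ 3
      exact mul_le_mul (le_abs_self κ) this (by positivity) (abs_nonneg κ)
    have h6 : C * ((C + 1) * (t - s) + h) * (t - s) ^ 2
        ≤ C * ((C + 1) * (c * h) + h) * (c * h) ^ 2 := by gcongr
    have h7 : (t - s) * C * h ^ 2 ≤ c * h * C * h ^ 2 := by gcongr
    have h8 : C₁ * h ^ 3 = C * ((C + 1) * (c * h) + h) * (c * h) ^ 2 + c * h * C * h ^ 2
        + |κ| * (c * h) ^ 3 := by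
      rw [hC₁]; ring
    have h9 : ‖y - (w + H (refNode q))‖
        ≤ C * ((C + 1) * (t - s) + h) * (t - s) ^ 2 + (t - s) * C * h ^ 2 := h2
    linarith
  -- The displacements are the O(h³) node errors pulled back by H; division by σh/4 leaves O(h²) and
  -- explains the factor 4/σ.
  refine ⟨fun q => K (Φ (M.node j q) - w) - refNode q, hinj, fun q => ?_, fun q => ?_, hε⟩
  · rw [add_sub_cancel, hHK, add_sub_cancel]
  · have h1 := hlow (K (Φ (M.node j q) - w) - refNode q)
    rw [map_sub H, hHK, sub_sub] at h1
    have h2 := h1.trans (herr q)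
    rw [← le_div_iff₀' hm] at h2
    refine h2.trans (le_of_eq ?_)
    field_simp

/-! ### Consistency of the transported integrals -/

lemma abs_mul_sub_mul_le (x x' y y' : ℝ) : |x * y - x' * y'| ≤ |x| * |y - y'| + |x - x'| * |y'| := by
  rw [← abs_mul, ← abs_mul, show x * y - x' * y' = x * (y - y') + (x - x') * y' by ring]
  exact abs_add_le _ _

lemma abs_le_add_of_abs_sub_le {x y b e : ℝ} (hy : |y| ≤ b) (h : |x - y| ≤ e) : |x| ≤ b + e := by
  have := abs_add_le (x - y) y
  rw [sub_add_cancel] at this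
  linarith

/-- Combination of the expansions of the solution, the Jacobians and the test function. -/
lemma product_estimate {C C₁ C₂ C₃ C₄ C₅ C₆ C₇ c : ℝ} (hC : 0 ≤ C) (hC₁ : 0 ≤ C₁) (hC₂ : 0 ≤ C₂)
    (hC₃ : 0 ≤ C₃) (hC₄ : 0 ≤ C₄) (hC₅ : 0 ≤ C₅) (hC₆ : 0 ≤ C₆) (hC₇ : 0 ≤ C₇) (hc : 0 ≤ c) :
    ∃ C', 0 ≤ C' ∧ ∀ U X Y Z W F K d Δ h m : ℝ, 0 ≤ h → h ≤ 1 → 0 ≤ m → 0 ≤ Δ → Δ ≤ c * h →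
      |U| ≤ C → |K| ≤ C₂ → |d| ≤ C₃ → |K + U * d| ≤ C₄ * h → |X - (U - Δ * K)| ≤ C₁ * h ^ 2 →
      |Y - (1 - Δ * d)| ≤ C₅ * h ^ 2 → |Z - 1| ≤ C₆ * h ^ 2 → |W - F| ≤ C₇ * h ^ 2 * m →
      |F| ≤ 2400 * m → |X * Y * Z * W - U * F| ≤ C' * h ^ 2 * m := by
  set E₁ := (C + c * C₂ + C₁) * C₅ + C₁ * (1 + c * C₃) + (c * C₄ + c ^ 2 * (C₂ * C₃)) with hE₁
  have hE₁0 : 0 ≤ E₁ := by positivity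
  set E₂ := (C + E₁) * C₆ + E₁ with hE₂
  have hE₂0 : 0 ≤ E₂ := by positivity
  refine ⟨(C + E₂) * C₇ + E₂ * 2400, by positivity, ?_⟩
  -- In the application U and X are the solution at the new point and at the approximate foot, Y and
  -- Z the Jacobians of the affine step and of the perturbation, W and F the fitted and original
  -- test functions, K the derivative of u along the flow, d the divergence of the velocity, and m
  -- the nodal norm of the test function.
  intro U X Y Z W F K d Δ h m hh hh1 hm hΔ hΔc hU hK hd hKd hX hY hZ hW hF
  have hh2 : h ^ 2 ≤ 1 := pow_le_one₀ hh hh1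
  have hh20 : 0 ≤ h ^ 2 := sq_nonneg h
  have hΔc' : Δ ≤ c := hΔc.trans (mul_le_of_le_one_right hc hh1)
  have hΔK : |Δ * K| ≤ c * C₂ := by
    rw [abs_mul, abs_of_nonneg hΔ]; gcongr
  have hΔd : |Δ * d| ≤ c * C₃ := by
    rw [abs_mul, abs_of_nonneg hΔ]; gcongr
  have hX' : |X| ≤ C + c * C₂ + C₁ := by
    refine (abs_le_add_of_abs_sub_le (b := C + c * C₂) ?_ hX).trans ?_
    · exact (abs_sub _ _).trans (add_le_add hU hΔK)
    · gcongr
      exact mul_le_of_le_one_right hC₁ hh2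
  have h1d : |1 - Δ * d| ≤ 1 + c * C₃ := (abs_sub _ _).trans (by rw [abs_one]; gcongr)
  have e1 : |X * Y - (U - Δ * K) * (1 - Δ * d)|
      ≤ (C + c * C₂ + C₁) * (C₅ * h ^ 2) + C₁ * h ^ 2 * (1 + c * C₃) :=
    (abs_mul_sub_mul_le _ _ _ _).trans (by gcongr)
  have e2 : |(U - Δ * K) * (1 - Δ * d) - U| ≤ (c * C₄ + c ^ 2 * (C₂ * C₃)) * h ^ 2 := by
    -- The cancellation behind consistency: by the transport equation K + U d is O(h), so the term
    -- linear in Δ is O(h²).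
    rw [show (U - Δ * K) * (1 - Δ * d) - U = -(Δ * (K + U * d)) + Δ ^ 2 * (K * d) by ring]
    refine (abs_add_le _ _).trans ?_
    rw [abs_neg, abs_mul, abs_mul, abs_mul, abs_of_nonneg hΔ, abs_of_nonneg (sq_nonneg Δ)]
    have k1 : Δ * |K + U * d| ≤ c * h * (C₄ * h) := by gcongr
    have k2 : Δ ^ 2 * (|K| * |d|) ≤ (c * h) ^ 2 * (C₂ * C₃) := by gcongr
    nlinarith
  have e3 : |X * Y - U| ≤ E₁ * h ^ 2 := by
    have := abs_sub_le (X * Y) ((U - Δ * K) * (1 - Δ * d)) U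
    rw [hE₁]
    linarith
  have hXY : |X * Y| ≤ C + E₁ :=
    (abs_le_add_of_abs_sub_le hU e3).trans (by gcongr; exact mul_le_of_le_one_right hE₁0 hh2)
  have e4 : |X * Y * Z - U| ≤ E₂ * h ^ 2 := by
    have := abs_mul_sub_mul_le (X * Y) U Z 1
    rw [mul_one, abs_one, mul_one] at this
    refine this.trans ?_
    have k1 : |X * Y| * |Z - 1| ≤ (C + E₁) * (C₆ * h ^ 2) := by gcongr
    rw [hE₂]
    linarith
  have hXYZ : |X * Y * Z| ≤ C + E₂ :=
    (abs_le_add_of_abs_sub_le hU e4).trans (by gcongr; exact mul_le_of_le_one_right hE₂0 hh2)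
  refine (abs_mul_sub_mul_le _ _ _ _).trans ?_
  have k1 : |X * Y * Z| * |W - F| ≤ (C + E₂) * (C₇ * h ^ 2 * m) := by gcongr
  have k2 : |X * Y * Z - U| * |F| ≤ E₂ * h ^ 2 * (2400 * m) := by gcongr
  linarith

section Step

variable {S : Set (Plane × ℝ)} {A : Plane × ℝ → Plane} {u : Plane × ℝ → ℝ} {C : ℝ}

/-- First-order expansion of the solution along the approximate backward characteristics. -/
lemma DataBounds.sol_step (hD : DataBounds S A u C) {c e : ℝ} (hc : 0 ≤ c) (he : 0 ≤ e) :
    ∃ C', 0 ≤ C' ∧ ∀ (x₀ x y ξ ζ : Plane) (s t h : ℝ) (L : Plane →L[ℝ] Plane), 0 ≤ h → h ≤ 1 →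
      s ≤ t → t - s ≤ c * h → (∀ v, ‖L v‖ ≤ 2 * h * ‖v‖) → ‖ζ - ξ‖ ≤ e * h ^ 2 → ‖ζ‖ ≤ 2 →
      (x₀, t) ∈ S → (x, t) ∈ S → (y, s) ∈ S → ‖x - x₀‖ ≤ h → x = x₀ + L ξ →
      y = stepBase A (x₀, t) (t - s) + stepLin A (x₀, t) (t - s) (L ζ) →
      |u (y, s) - (u (x, t) - (t - s) * fderiv ℝ u (x₀, t) (A (x₀, t), 1))| ≤ C' * h ^ 2 := by
  have hC0 : 0 ≤ C := zero_le_one.trans hD.one_le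
  set R := c ^ 2 * C + 2 * e + 4 * c * C with hR
  have hR0 : 0 ≤ R := by positivity
  set Q := c * C + R + c with hQ
  have hQ0 : 0 ≤ Q := by positivity
  refine ⟨C * Q ^ 2 + C * R + c * (C * (C + 1)), by positivity, ?_⟩
  intro x₀ x y ξ ζ s t h L hh hh1 hst hΔ hL hζξ hζ hp₀ hp hq hxx₀ hx hy
  set Δ := t - s with hΔdef
  have hΔ0 : 0 ≤ Δ := sub_nonneg.2 hst
  have hh2 : h ^ 2 ≤ h := by nlinarith
  -- To first order the foot is x - Δ A(x₀, t); r collects the acceleration, the node perturbation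
  -- and the velocity gradient, all O(h²).
  set r := y - x + Δ • A (x₀, t) with hr
  have hr' : r = (Δ ^ 2 / 2) • accel A (x₀, t) + L (ζ - ξ) - Δ • spaceDeriv A (x₀, t) (L ζ) := by
    rw [hr, hy, hx]
    simp only [stepBase, stepLin, sub_apply, smul_apply, ContinuousLinearMap.id_apply, map_sub]
    abel
  have hrn : ‖r‖ ≤ R * h ^ 2 := by
    rw [hr']
    refine (norm_sub_le _ _).trans ((add_le_add_left (norm_add_le _ _) _).trans ?_)
    have k1 : ‖(Δ ^ 2 / 2) • accel A (x₀, t)‖ ≤ (c * h) ^ 2 * C := by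
      rw [norm_smul, Real.norm_of_nonneg (by positivity)]
      have : Δ ^ 2 / 2 ≤ (c * h) ^ 2 := by
        have := pow_le_pow_left₀ hΔ0 hΔ 2
        nlinarith [sq_nonneg Δ]
      exact mul_le_mul this (hD.accel_le _ hp₀) (norm_nonneg _) (by positivity)
    have k2 : ‖L (ζ - ξ)‖ ≤ 2 * (e * h ^ 2) := by
      refine (hL _).trans ?_
      calc 2 * h * ‖ζ - ξ‖ ≤ 2 * 1 * (e * h ^ 2) := by gcongr
        _ = _ := by ring
    have k3 : ‖Δ • spaceDeriv A (x₀, t) (L ζ)‖ ≤ c * h * (C * (2 * h * 2)) := by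
      rw [norm_smul, Real.norm_of_nonneg hΔ0]
      have e1 := (spaceDeriv A (x₀, t)).le_of_opNorm_le (hD.norm_spaceDeriv_le hp₀) (L ζ)
      have e2 : ‖L ζ‖ ≤ 2 * h * 2 := (hL ζ).trans (by gcongr)
      have e3 : ‖spaceDeriv A (x₀, t) (L ζ)‖ ≤ C * (2 * h * 2) :=
        e1.trans (mul_le_mul_of_nonneg_left e2 hC0)
      exact mul_le_mul hΔ e3 (norm_nonneg _) (by positivity)
    rw [hR]
    nlinarith
  have hsplit : ((y, s) : Plane × ℝ) - (x, t) = -(Δ • (A (x₀, t), (1 : ℝ))) + (r, 0) := by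
    ext1
    · simp [hr]
    · simp [hΔdef]
  have hA1 : ‖((A (x₀, t), (1 : ℝ)) : Plane × ℝ)‖ ≤ C + 1 :=
    (norm_prod_le_add _ _).trans (by simpa using hD.vel_le _ hp₀)
  have hr0 : ‖((r, (0 : ℝ)) : Plane × ℝ)‖ ≤ R * h ^ 2 :=
    (norm_prod_le_add _ _).trans (by simpa using hrn)
  have hqp : ‖((y, s) : Plane × ℝ) - (x, t)‖ ≤ Q * h := by
    rw [hsplit]
    refine (norm_add_le _ _).trans ?_
    rw [norm_neg, norm_smul, Real.norm_of_nonneg hΔ0]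
    have k1 : Δ * ‖((A (x₀, t), (1 : ℝ)) : Plane × ℝ)‖ ≤ c * h * (C + 1) :=
      mul_le_mul hΔ hA1 (norm_nonneg _) (by positivity)
    have k2 : R * h ^ 2 ≤ R * h := mul_le_mul_of_nonneg_left hh2 hR0
    rw [hQ]
    nlinarith
  have t1 : |u (y, s) - u (x, t) - fderiv ℝ u (x, t) ((y, s) - (x, t))| ≤ C * (Q * h) ^ 2 :=
    (hD.sol_taylor _ hp _ hq).trans
      (mul_le_mul_of_nonneg_left (pow_le_pow_left₀ (norm_nonneg _) hqp 2) hC0)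
  have t2 : |fderiv ℝ u (x, t) (r, 0)| ≤ C * (R * h ^ 2) :=
    ((fderiv ℝ u (x, t)).le_opNorm _).trans
      (mul_le_mul (hD.dsol_le _ hp) hr0 (norm_nonneg _) hC0)
  have t3 : |(fderiv ℝ u (x, t) - fderiv ℝ u (x₀, t)) (A (x₀, t), 1)| ≤ C * h * (C + 1) := by
    refine ((fderiv ℝ u (x, t) - fderiv ℝ u (x₀, t)).le_opNorm _).trans ?_
    refine mul_le_mul ((hD.dsol_lip _ hp₀ _ hp).trans (mul_le_mul_of_nonneg_left ?_ hC0)) hA1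
      (norm_nonneg _) (by positivity)
    rw [Prod.mk_sub_mk, sub_self]
    exact (norm_prod_le_add _ _).trans (by simpa using hxx₀)
  have t4 : |Δ * (fderiv ℝ u (x, t) - fderiv ℝ u (x₀, t)) (A (x₀, t), 1)|
      ≤ c * h * (C * h * (C + 1)) := by
    rw [abs_mul, abs_of_nonneg hΔ0]
    exact mul_le_mul hΔ t3 (abs_nonneg _) (by positivity)
  have heq : u (y, s) - (u (x, t) - Δ * fderiv ℝ u (x₀, t) (A (x₀, t), 1))
      = (u (y, s) - u (x, t) - fderiv ℝ u (x, t) ((y, s) - (x, t)))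
        + fderiv ℝ u (x, t) (r, 0)
        - Δ * (fderiv ℝ u (x, t) - fderiv ℝ u (x₀, t)) (A (x₀, t), 1) := by
    rw [hsplit, map_add, map_neg, map_smul, sub_apply, smul_eq_mul]
    ring
  rw [heq]
  refine (abs_sub _ _).trans ((add_le_add_left (abs_add_le _ _) _).trans ?_)
  nlinarith

lemma DataBounds.abs_det_stepLin_sub_le (hD : DataBounds S A u C) {p : Plane × ℝ} (hp : p ∈ S)
    {Δ : ℝ} (hΔ : 0 ≤ Δ) (hΔC : 2 * (Δ * C) ≤ 1) :
    |(|(stepLin A p Δ).det|) - (1 - Δ * divg (spaceDeriv A p))| ≤ 2 * (Δ * C) ^ 2 := by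
  have hP : ‖-(Δ • spaceDeriv A p)‖ ≤ Δ * C := by
    rw [norm_neg, norm_smul, Real.norm_of_nonneg hΔ]
    exact mul_le_mul_of_nonneg_left (hD.norm_spaceDeriv_le hp) hΔ
  have h1 := abs_det_id_add_sub_le hP
  have h2 := abs_divg_le hP
  have h3 : divg (-(Δ • spaceDeriv A p)) = -(Δ * divg (spaceDeriv A p)) := by
    simp [divg]
    ring
  rw [h3, ← sub_eq_add_neg, ← sub_eq_add_neg] at h1
  rw [h3, abs_neg] at h2
  -- Nonnegativity of the first-order value lets the estimate pass to the absolute value of the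
  -- determinant.
  have h4 : 0 ≤ 1 - Δ * divg (spaceDeriv A p) := by linarith [le_abs_self (Δ * divg (spaceDeriv A p))]
  have h5 := abs_abs_sub_abs_le (stepLin A p Δ).det (1 - Δ * divg (spaceDeriv A p))
  rw [abs_of_nonneg h4] at h5
  exact h5.trans h1

lemma DataBounds.abs_sol_sub_linear_le (hD : DataBounds S A u C) {x₀ x : Plane} {t h : ℝ}
    (hp₀ : (x₀, t) ∈ S) (hp : (x, t) ∈ S) (hxx₀ : ‖x - x₀‖ ≤ h) :
    |u (x, t) - (u (x₀, t) + fderiv ℝ u (x₀, t) (x - x₀, 0))| ≤ C * h ^ 2 := by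
  have := hD.sol_taylor _ hp₀ _ hp
  rw [Prod.mk_sub_mk, sub_self, sub_sub] at this
  refine this.trans (mul_le_mul_of_nonneg_left ?_ (zero_le_one.trans hD.one_le))
  exact pow_le_pow_left₀ (norm_nonneg _) ((norm_prod_le_add _ _).trans (by simpa using hxx₀)) 2

/-- The transport equation at the base point, with the solution evaluated nearby. -/
lemma DataBounds.abs_pde_le (hD : DataBounds S A u C) {x₀ x : Plane} {t h : ℝ} (hh1 : h ≤ 1)
    (hp₀ : (x₀, t) ∈ S) (hp : (x, t) ∈ S) (hxx₀ : ‖x - x₀‖ ≤ h) :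
    |fderiv ℝ u (x₀, t) (A (x₀, t), 1) + u (x, t) * divg (spaceDeriv A (x₀, t))|
      ≤ 4 * C ^ 2 * h := by
  have hC0 : 0 ≤ C := zero_le_one.trans hD.one_le
  have hh0 : 0 ≤ h := (norm_nonneg _).trans hxx₀
  have h1 := hD.abs_sol_sub_linear_le hp₀ hp hxx₀
  have h2 : |fderiv ℝ u (x₀, t) (x - x₀, 0)| ≤ C * h :=
    ((fderiv ℝ u (x₀, t)).le_opNorm _).trans (mul_le_mul (hD.dsol_le _ hp₀)
      ((norm_prod_le_add _ _).trans (by simpa using hxx₀)) (norm_nonneg _) hC0)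
  have h3 : |u (x, t) - u (x₀, t)| ≤ 2 * C * h := by
    have e1 : u (x, t) - u (x₀, t) = (u (x, t) - (u (x₀, t) + fderiv ℝ u (x₀, t) (x - x₀, 0)))
        + fderiv ℝ u (x₀, t) (x - x₀, 0) := by ring
    rw [e1]
    refine (abs_add_le _ _).trans ?_
    have : C * h ^ 2 ≤ C * h := mul_le_mul_of_nonneg_left (by nlinarith) hC0
    linarith
  have h4 := abs_divg_le (hD.norm_spaceDeriv_le hp₀)
  have h5 := hD.pde _ hp₀
  have h6 : fderiv ℝ u (x₀, t) (A (x₀, t), 1) + u (x, t) * divg (spaceDeriv A (x₀, t))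
      = (u (x, t) - u (x₀, t)) * divg (spaceDeriv A (x₀, t)) := by linarith
  rw [h6, abs_mul]
  calc _ ≤ 2 * C * h * (2 * C) := mul_le_mul h3 h4 (abs_nonneg _) (by positivity)
    _ = _ := by ring

end Step

lemma continuous_perturbDeriv (ρ : Fin 7 → Plane) : Continuous (perturbDeriv ρ) := by
  have hs : ∀ i, Continuous (shapeDeriv i) := fun i => by
    have h : ∀ k : Fin 2, Continuous fun ξ : Plane => ξ k := fun k => by fun_prop
    have : Continuous fun ξ => shapePartial ξ i := by
      fin_cases i <;> simp only [shapePartial] <;> fun_prop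
    exact (this.fst.smul continuous_const).add (this.snd.smul continuous_const)
  refine continuous_finsetSum _ fun i _ => ?_
  exact (ContinuousLinearMap.smulRightL ℝ Plane Plane).continuous₂.comp₂ (hs i) continuous_const

lemma continuous_perturb (ρ : Fin 7 → Plane) : Continuous (perturb ρ) :=
  continuous_iff_continuousAt.2 fun ξ => (hasFDerivAt_perturb ρ ξ).continuousAt

/-- The exact solution, integrated over the upstream element against the reconstructed test
function, agrees up to second order (relative to the area) with the exact solution at the new time
integrated against the original test function. -/
lemma exists_consistency {Ω : Set Plane} {T C : ℝ} {A : Plane × ℝ → Plane} {u : Plane × ℝ → ℝ}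
    (hD : DataBounds (closure Ω ×ˢ Icc 0 T) A u C) {c e : ℝ} (hc : 0 ≤ c) (he : 0 ≤ e) :
    ∃ C', 0 ≤ C' ∧ ∀ (J : ℕ) (M : TriMesh J) (s t : ℝ) (Φ : Plane → Plane) (j : Fin J)
      (ρ : Fin 7 → Plane), M.region ⊆ closure Ω → 0 ≤ s → s ≤ t → t ≤ T → t - s ≤ c * M.size →
      M.size ≤ 1 → 2 * (c * C) * M.size ≤ 1 → Function.Injective (M.cellLin j) →
      Traced M Φ j (stepBase A (M.vert j 0, t) (t - s))
        ((stepLin A (M.vert j 0, t) (t - s)).comp (M.cellLin j)) ρ (e * M.size ^ 2) →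
      upstream M Φ j ⊆ M.region → ∀ Ψ ψ : Poly 2, IsLeastSquaresFit M Φ j Ψ ψ →
      |(∫ x in upstream M Φ j, u (x, s) * pval ψ x) - ∫ x in M.cell j, u (x, t) * pval Ψ x|
        ≤ C' * M.size ^ 2 * (|(M.cellLin j).det|
          * nodalNorm fun ξ => pval Ψ (M.vert j 0 + M.cellLin j ξ)) := by
  have hC0 : 0 ≤ C := zero_le_one.trans hD.one_le
  obtain ⟨C₁, hC₁, hstep⟩ := hD.sol_step hc (e := 2400 * e) (by positivity)
  -- `C₆` combines the trace and determinant of the perturbation derivative, of norm at most 600 e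
  -- h². In `C₇` the first term, 600 · 2400 e, comes from moving the argument of the test function,
  -- the second from the fit error.
  obtain ⟨C₂, hC₂, hprod⟩ := product_estimate (C := C) (C₁ := C₁) (C₂ := C * (C + 1)) (C₃ := 2 * C)
    (C₄ := 4 * C ^ 2) (C₅ := 2 * (c * C) ^ 2) (C₆ := 2 * (600 * e) + 2 * (600 * e) ^ 2)
    (C₇ := 1440000 * e + 2400 * (4800 * e)) (c := c) hC0 hC₁ (by positivity) (by positivity)
    (by positivity) (by positivity) (by positivity) (by positivity) hc
  refine ⟨C₂ * volume.real refTri, by positivity, ?_⟩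
  intro J M s t Φ j ρ hreg hs hst ht hΔ hh1 hΔC hinj hT hup Ψ ψ hfit
  set h := M.size with hh
  set x₀ := M.vert j 0 with hx₀
  set L := M.cellLin j with hL
  set w := stepBase A (x₀, t) (t - s) with hw
  set E := stepLin A (x₀, t) (t - s) with hE
  set Ψ' : Plane → ℝ := fun ξ => pval Ψ (x₀ + L ξ) with hΨ'
  set ψ' : Plane → ℝ := fun ξ => pval ψ (w + E.comp L ξ) with hψ'
  set m := nodalNorm Ψ' with hm
  have hm0 : 0 ≤ m := nodalNorm_nonneg _
  have hpos : 0 < h := M.size_pos j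
  have hΔ0 : 0 ≤ t - s := sub_nonneg.2 hst
  have hΔC' : 2 * ((t - s) * C) ≤ 1 := by
    have := mul_le_mul_of_nonneg_right hΔ hC0
    nlinarith
  have hcell : ∀ {x}, x ∈ M.cell j → (x, t) ∈ closure Ω ×ˢ Icc 0 T := fun hx =>
    ⟨hreg (mem_iUnion.2 ⟨j, hx⟩), hs.trans hst, ht⟩
  have hcell' : ∀ ξ ∈ refTri, x₀ + L ξ ∈ M.cell j := fun ξ hξ => by
    rw [M.cell_eq_image]; exact ⟨ξ, hξ, rfl⟩
  have hups : ∀ ξ ∈ refTri, w + E.comp L (perturb ρ ξ) ∈ closure Ω := fun ξ hξ =>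
    hreg (hup (by rw [hT.upstream_eq]; exact ⟨ξ, hξ, rfl⟩))
  have hp₀ : (x₀, t) ∈ closure Ω ×ˢ Icc 0 T := hcell (M.vert_mem_cell j 0)
  have hΨq : IsQuad Ψ' := (isQuad_pval Ψ).comp_affine _ _
  have hψq : IsQuad ψ' := (isQuad_pval ψ).comp_affine _ _
  have hfit' := hT.fit_estimate hfit
  have hdet : |(E.comp L).det| = |E.det| * |L.det| := by
    rw [← abs_mul]
    exact congrArg _ (LinearMap.det_comp _ _)
  have hpt : ∀ ξ ∈ refTri, |u (w + E.comp L (perturb ρ ξ), s) * |E.det|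
      * |(ContinuousLinearMap.id ℝ Plane + perturbDeriv ρ ξ).det| * ψ' (perturb ρ ξ)
      - u (x₀ + L ξ, t) * Ψ' ξ| ≤ C₂ * h ^ 2 * m := fun ξ hξ => by
    have hξ1 := norm_le_one_of_mem_refTri hξ
    have hξ3 : ‖ξ‖ ≤ 3 := by linarith
    have hg2 := hT.norm_perturb_le hξ
    have hgd : ‖perturb ρ ξ - ξ‖ ≤ 2400 * e * h ^ 2 :=
      (norm_perturb_sub_le hT.small hξ3).trans (le_of_eq (by ring))
    have hxx₀ : ‖x₀ + L ξ - x₀‖ ≤ h := M.norm_sub_le_size j (hcell' ξ hξ) (M.vert_mem_cell j 0)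
    refine hprod _ _ _ _ _ _ (fderiv ℝ u (x₀, t) (A (x₀, t), 1)) (divg (spaceDeriv A (x₀, t)))
      (t - s) h m hpos.le hh1 hm0 hΔ0 hΔ (hD.sol_le _ (hcell (hcell' ξ hξ))) ?_
      (abs_divg_le (hD.norm_spaceDeriv_le hp₀))
      (hD.abs_pde_le hh1 hp₀ (hcell (hcell' ξ hξ)) hxx₀) ?_ ?_ ?_ ?_ (hΨq.abs_le hξ3)
    · exact ((fderiv ℝ u (x₀, t)).le_opNorm _).trans (mul_le_mul (hD.dsol_le _ hp₀)
        ((norm_prod_le_add _ _).trans (by simpa using hD.vel_le _ hp₀)) (norm_nonneg _) hC0)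
    · exact hstep x₀ (x₀ + L ξ) _ ξ (perturb ρ ξ) s t h L hpos.le hh1 hst hΔ
        (M.norm_cellLin_apply_le j) hgd hg2 hp₀ (hcell (hcell' ξ hξ))
        ⟨hups ξ hξ, hs, hst.trans ht⟩ hxx₀ rfl rfl
    · refine (hD.abs_det_stepLin_sub_le hp₀ hΔ0 hΔC').trans ?_
      have : ((t - s) * C) ^ 2 ≤ (c * h * C) ^ 2 := by gcongr
      nlinarith
    · have hP := norm_perturbDeriv_le hT.small hξ3
      have e1 := abs_det_id_add_sub_le hP
      have e2 := abs_divg_le hP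
      have e3 := abs_abs_sub_abs_le (ContinuousLinearMap.id ℝ Plane + perturbDeriv ρ ξ).det 1
      rw [abs_one] at e3
      have e4 : |(ContinuousLinearMap.id ℝ Plane + perturbDeriv ρ ξ).det - 1|
          ≤ |(ContinuousLinearMap.id ℝ Plane + perturbDeriv ρ ξ).det - (1 + divg (perturbDeriv ρ ξ))|
            + |divg (perturbDeriv ρ ξ)| := by
        refine le_trans (le_of_eq ?_) (abs_add_le _ _)
        congr 1
        ring
      have e5 : (600 * (e * h ^ 2)) ^ 2 ≤ (600 * e) ^ 2 * h ^ 2 := by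
        have : h ^ 2 * h ^ 2 ≤ h ^ 2 := mul_le_of_le_one_right (sq_nonneg h) (pow_le_one₀ hpos.le hh1)
        nlinarith [mul_le_mul_of_nonneg_left this (sq_nonneg (600 * e))]
      nlinarith
    · have e1 := hΨq.abs_sub_le hξ3 (hg2.trans (by norm_num))
      have e2 := (hψq.sub hΨq).abs_le (hg2.trans (by norm_num : (2 : ℝ) ≤ 3))
      have e3 : |ψ' (perturb ρ ξ) - Ψ' ξ| ≤ |ψ' (perturb ρ ξ) - Ψ' (perturb ρ ξ)|
          + |Ψ' (perturb ρ ξ) - Ψ' ξ| := abs_sub_le _ _ _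
      have e4 : 600 * m * ‖perturb ρ ξ - ξ‖ ≤ 600 * m * (2400 * e * h ^ 2) := by gcongr
      have e5 : nodalNorm (fun ξ => ψ' ξ - Ψ' ξ) ≤ 4800 * (e * h ^ 2) * m := hfit'
      nlinarith
  have hc1 : ContinuousOn (fun ξ => u (w + E.comp L (perturb ρ ξ), s) * |E.det|
      * |(ContinuousLinearMap.id ℝ Plane + perturbDeriv ρ ξ).det| * ψ' (perturb ρ ξ)) refTri := by
    have k1 : ContinuousOn (fun ξ => u (w + E.comp L (perturb ρ ξ), s)) refTri := by
      refine hD.cont.comp (f := fun ξ => (w + E.comp L (perturb ρ ξ), s)) ?_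
        fun ξ hξ => ⟨hups ξ hξ, hs, hst.trans ht⟩
      exact ((continuous_const.add ((E.comp L).continuous.comp (continuous_perturb ρ))).prodMk
        continuous_const).continuousOn
    have k2 : Continuous fun ξ => |(ContinuousLinearMap.id ℝ Plane + perturbDeriv ρ ξ).det| :=
      (ContinuousLinearMap.continuous_det.comp
        (continuous_const.add (continuous_perturbDeriv ρ))).abs
    exact ((k1.mul continuousOn_const).mul k2.continuousOn).mul
      (hψq.continuous.comp (continuous_perturb ρ)).continuousOn
  have hc2 : ContinuousOn (fun ξ => u (x₀ + L ξ, t) * Ψ' ξ) refTri := by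
    refine ContinuousOn.mul ?_ hΨq.continuous.continuousOn
    refine hD.cont.comp (f := fun ξ => (x₀ + L ξ, t)) ?_ fun ξ hξ => hcell (hcell' ξ hξ)
    exact ((continuous_const.add L.continuous).prodMk continuous_const).continuousOn
  -- Both integrals carry the factor |det L|; factoring it out makes the remaining error relative to
  -- the area of the cell.
  have heq : (∫ x in upstream M Φ j, u (x, s) * pval ψ x) - ∫ x in M.cell j, u (x, t) * pval Ψ x
      = |L.det| * ∫ ξ in refTri, (u (w + E.comp L (perturb ρ ξ), s) * |E.det|
      * |(ContinuousLinearMap.id ℝ Plane + perturbDeriv ρ ξ).det| * ψ' (perturb ρ ξ)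
      - u (x₀ + L ξ, t) * Ψ' ξ) := by
    rw [integral_sub (hc1.integrableOn_compact isCompact_refTri)
      (hc2.integrableOn_compact isCompact_refTri), mul_sub, setIntegral_cell M j hinj,
      hT.setIntegral_upstream]
    congr 1
    rw [← integral_const_mul]
    refine integral_congr_ae (Filter.Eventually.of_forall fun ξ => ?_)
    simp only [hdet, hψ']
    ring
  rw [heq, abs_mul, abs_abs]
  have hfin : |∫ ξ in refTri, (u (w + E.comp L (perturb ρ ξ), s) * |E.det|
      * |(ContinuousLinearMap.id ℝ Plane + perturbDeriv ρ ξ).det| * ψ' (perturb ρ ξ)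
      - u (x₀ + L ξ, t) * Ψ' ξ)| ≤ C₂ * h ^ 2 * m * volume.real refTri := by
    rw [← Real.norm_eq_abs]
    exact norm_setIntegral_le_of_norm_le_const isCompact_refTri.measure_lt_top hpt
  calc _ ≤ |L.det| * (C₂ * h ^ 2 * m * volume.real refTri) :=
        mul_le_mul_of_nonneg_left hfin (abs_nonneg _)
    _ = _ := by ring

/-! ### The error inherited from the previous time level -/

/-- Cauchy–Schwarz against the constant 1; on a cell it gains the factor h from the square root of
the area. -/
lemma setIntegral_abs_le_of_eLpNorm_le {K : Set Plane} {f : Plane → ℝ}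
    (hf : AEStronglyMeasurable f (volume.restrict K)) (hK : volume K ≠ ⊤) {α : ℝ} (hα : 0 ≤ α)
    (h : eLpNorm f 2 (volume.restrict K) ≤ ENNReal.ofReal α) :
    ∫ x in K, |f x| ≤ α * Real.sqrt (volume.real K) := by
  have h1 := eLpNorm_le_eLpNorm_mul_rpow_measure_univ (p := 1) (q := 2) (by norm_num) hf
  have h2 : eLpNorm f 1 (volume.restrict K)
      ≤ ENNReal.ofReal (α * Real.sqrt (volume.real K)) := by
    refine h1.trans ?_
    rw [ENNReal.ofReal_mul hα]
    refine mul_le_mul' h (le_of_eq ?_)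
    rw [Measure.restrict_apply_univ, Real.sqrt_eq_rpow, ← ENNReal.ofReal_rpow_of_nonneg
      measureReal_nonneg (by norm_num), ofReal_measureReal hK]
    norm_num
  rw [eLpNorm_one_eq_lintegral_enorm] at h2
  have h3 := integral_norm_eq_lintegral_enorm hf
  simp only [Real.norm_eq_abs] at h3
  rw [h3]
  exact ENNReal.toReal_le_of_le_ofReal (by positivity) h2

lemma TriMesh.sqrt_volume_real_cell_le {J : ℕ} (M : TriMesh J) (j : Fin J) :
    Real.sqrt (volume.real (M.cell j))
      ≤ M.size * Real.sqrt (volume.real (Metric.ball (0 : Plane) 1)) := by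
  conv_rhs => rw [← Real.sqrt_sq (M.size_pos j).le, ← Real.sqrt_mul (sq_nonneg M.size)]
  exact Real.sqrt_le_sqrt (TriMesh.volume_real_cell_le j)

/-- Cells with disjoint interiors can meet only in their frontiers, which are null because the cells
are convex. -/
lemma TriMesh.aedisjoint_cell {J : ℕ} (M : TriMesh J) :
    Pairwise (Function.onFun (AEDisjoint volume) M.cell) := fun l k hlk => by
  have hsub : M.cell l ∩ M.cell k ⊆ frontier (M.cell l) ∪ frontier (M.cell k) := by
    rintro x ⟨hl, hk⟩
    by_contra hx
    rw [mem_union, not_or] at hx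
    have e1 : x ∈ interior (M.cell l) := by
      by_contra h
      exact hx.1 ⟨subset_closure hl, h⟩
    have e2 : x ∈ interior (M.cell k) := by
      by_contra h
      exact hx.2 ⟨subset_closure hk, h⟩
    exact (disjoint_left.1 (M.nonoverlapping hlk)) e1 e2
  exact measure_mono_null hsub (measure_union_null ((M.convex_cell l).addHaar_frontier volume)
    ((M.convex_cell k).addHaar_frontier volume))

lemma TriMesh.setIntegral_eq_sum {J : ℕ} (M : TriMesh J) {D : Set Plane} (hD : MeasurableSet D)
    (hsub : D ⊆ M.region) {f : Plane → ℝ} (hf : IntegrableOn f D) :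
    ∫ x in D, f x = ∑ l, ∫ x in D ∩ M.cell l, f x := by
  have hU : D = ⋃ l, D ∩ M.cell l := by
    rw [← inter_iUnion]
    exact (inter_eq_left.2 hsub).symm
  have := integral_iUnion_ae (μ := volume) (f := f) (s := fun l => D ∩ M.cell l)
    (fun l => (hD.inter (M.measurableSet_cell l)).nullMeasurableSet)
    (fun l k hlk => (M.aedisjoint_cell hlk).mono inter_subset_right inter_subset_right)
    (by rwa [← hU])
  rw [← hU, tsum_fintype] at this
  exact this

lemma DataBounds.norm_stepLin_le {S : Set (Plane × ℝ)} {A : Plane × ℝ → Plane}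
    {u : Plane × ℝ → ℝ} {C : ℝ} (hD : DataBounds S A u C) {p : Plane × ℝ} (hp : p ∈ S) {Δ : ℝ}
    (hΔ : 0 ≤ Δ) (hΔC : 2 * (Δ * C) ≤ 1) (y : Plane) : ‖stepLin A p Δ y‖ ≤ 2 * ‖y‖ := by
  have h1 : ‖Δ • spaceDeriv A p y‖ ≤ 1 * ‖y‖ := by
    rw [norm_smul, Real.norm_of_nonneg hΔ]
    have := (spaceDeriv A p).le_of_opNorm_le (hD.norm_spaceDeriv_le hp) y
    calc Δ * ‖spaceDeriv A p y‖ ≤ Δ * (C * ‖y‖) := mul_le_mul_of_nonneg_left this hΔ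
      _ = Δ * C * ‖y‖ := by ring
      _ ≤ 1 * ‖y‖ := mul_le_mul_of_nonneg_right
          (by linarith [mul_nonneg hΔ (zero_le_one.trans hD.one_le)]) (norm_nonneg y)
  have h2 : ‖stepLin A p Δ y‖ ≤ ‖y‖ + ‖Δ • spaceDeriv A p y‖ := norm_sub_le _ _
  linarith

/-- The smallness of ε bounds the nodal error of the fit by twice the nodal norm of Ψ, so 7200 =
2400 · (1 + 2). -/
lemma Traced.abs_fit_le {J : ℕ} {M : TriMesh J} {Φ : Plane → Plane} {j : Fin J} {w : Plane}
    {H : Plane →L[ℝ] Plane} {ρ : Fin 7 → Plane} {ε : ℝ} (h : Traced M Φ j w H ρ ε) {Ψ ψ : Poly 2}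
    (hfit : IsLeastSquaresFit M Φ j Ψ ψ) {x : Plane} (hx : x ∈ upstream M Φ j) :
    |pval ψ x| ≤ 7200 * nodalNorm fun ξ => pval Ψ (M.vert j 0 + M.cellLin j ξ) := by
  rw [h.upstream_eq] at hx
  obtain ⟨ξ, hξ, rfl⟩ := hx
  have hΨ : IsQuad fun ξ => pval Ψ (M.vert j 0 + M.cellLin j ξ) := (isQuad_pval Ψ).comp_affine _ _
  have hψ : IsQuad fun ξ => pval ψ (w + H ξ) := (isQuad_pval ψ).comp_affine _ _
  have h3 : ‖perturb ρ ξ‖ ≤ 3 := (h.norm_perturb_le hξ).trans (by norm_num)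
  have e1 := (hψ.sub hΨ).abs_le h3
  have e2 := hΨ.abs_le h3
  have e3 := h.fit_estimate hfit
  have hm := nodalNorm_nonneg fun ξ => pval Ψ (M.vert j 0 + M.cellLin j ξ)
  have e4 : 4800 * ε * (nodalNorm fun ξ => pval Ψ (M.vert j 0 + M.cellLin j ξ))
      ≤ 2 * nodalNorm fun ξ => pval Ψ (M.vert j 0 + M.cellLin j ξ) :=
    mul_le_mul_of_nonneg_right (by linarith [h.eps_le]) hm
  have e5 := abs_le_add_of_abs_sub_le e2 e1
  linarith

/-- The contribution of the error at the previous time level to the right-hand side of the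
scheme. -/
lemma exists_remap_bound {Ω : Set Plane} {T C : ℝ} {A : Plane × ℝ → Plane} {u : Plane × ℝ → ℝ}
    (hD : DataBounds (closure Ω ×ˢ Icc 0 T) A u C) {σ : ℝ} (hσ : 0 < σ) (c C₀ : ℝ) :
    ∃ C', 0 ≤ C' ∧ ∀ (J : ℕ) (M : TriMesh J) (s t ε : ℝ) (Φ : Plane → Plane) (j : Fin J)
      (ρ : Fin 7 → Plane) (v : M.DGSpace 2), M.region ⊆ closure Ω → M.IsQuasiUniform σ → 0 ≤ s →
      s ≤ t → t ≤ T → t - s ≤ c * M.size → 2 * (c * C) * M.size ≤ 1 →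
      Traced M Φ j (stepBase A (M.vert j 0, t) (t - s))
        ((stepLin A (M.vert j 0, t) (t - s)).comp (M.cellLin j)) ρ ε →
      upstream M Φ j ⊆ M.region →
      (∀ l, cellError M l (v l) (fun x => u (x, s)) ≤ ENNReal.ofReal (C₀ * M.size ^ 3)) →
      ∀ Ψ ψ : Poly 2, IsLeastSquaresFit M Φ j Ψ ψ →
      |remapIntegral M (upstream M Φ j) v ψ - ∫ x in upstream M Φ j, u (x, s) * pval ψ x|
        ≤ C' * M.size ^ 4 * nodalNorm fun ξ => pval Ψ (M.vert j 0 + M.cellLin j ξ) := by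
  classical
  have hC0 : 0 ≤ C := zero_le_one.trans hD.one_le
  set V := volume.real (Metric.ball (0 : Plane) 1) with hV
  refine ⟨((8 + 1) / σ) ^ 2 * (7200 * (|C₀| * Real.sqrt V)), by positivity, ?_⟩
  intro J M s t ε Φ j ρ v hreg hM hs hst ht hΔ hΔC hT hup herr Ψ ψ hfit
  set h := M.size with hh
  set m := nodalNorm fun ξ => pval Ψ (M.vert j 0 + M.cellLin j ξ) with hm
  have hm0 : 0 ≤ m := nodalNorm_nonneg _
  have hpos : 0 < h := M.size_pos j
  have hΔ0 : 0 ≤ t - s := sub_nonneg.2 hst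
  have hΔC' : 2 * ((t - s) * C) ≤ 1 := by
    have := mul_le_mul_of_nonneg_right hΔ hC0
    nlinarith
  have hp₀ : (M.vert j 0, t) ∈ closure Ω ×ˢ Icc 0 T :=
    ⟨hreg (mem_iUnion.2 ⟨j, M.vert_mem_cell j 0⟩), hs.trans hst, ht⟩
  have hcomp := hT.isCompact_upstream
  have hmeas : MeasurableSet (upstream M Φ j) := hcomp.isClosed.measurableSet
  have hucont : ContinuousOn (fun x => u (x, s)) (closure Ω) :=
    hD.cont.comp (f := fun x : Plane => (x, s)) (by fun_prop)
      fun x hx => ⟨hx, hs, hst.trans ht⟩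
  have hcellΩ : ∀ l, M.cell l ⊆ closure Ω := fun l => (subset_iUnion M.cell l).trans hreg
  have hint : IntegrableOn (fun x => u (x, s) * pval ψ x) (upstream M Φ j) :=
    ((hucont.mono (hup.trans hreg)).mul (continuous_pval ψ).continuousOn).integrableOn_compact hcomp
  -- The radius 8h is a product of three factors: 2 for the time step, 2h for the cell map and 2 for
  -- the perturbed reference triangle.
  have hball : upstream M Φ j
      ⊆ Metric.closedBall (stepBase A (M.vert j 0, t) (t - s)) (8 * h) := by
    rw [hT.upstream_eq]
    rintro _ ⟨ξ, hξ, rfl⟩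
    rw [mem_closedBall_iff_norm, add_sub_cancel_left]
    have e1 := hD.norm_stepLin_le hp₀ hΔ0 hΔC' (M.cellLin j (perturb ρ ξ))
    have e2 := M.norm_cellLin_apply_le j (perturb ρ ξ)
    have e3 : 2 * h * ‖perturb ρ ξ‖ ≤ 2 * h * 2 :=
      mul_le_mul_of_nonneg_left (hT.norm_perturb_le hξ) (by positivity)
    change ‖stepLin A (M.vert j 0, t) (t - s) (M.cellLin j (perturb ρ ξ))‖ ≤ 8 * h
    linarith
  have hdiffc : ∀ l, ContinuousOn (fun x => pval (v l) x - u (x, s)) (M.cell l) := fun l =>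
    (continuous_pval _).continuousOn.sub (hucont.mono (hcellΩ l))
  have hdiff : remapIntegral M (upstream M Φ j) v ψ - ∫ x in upstream M Φ j, u (x, s) * pval ψ x
      = ∑ l, ∫ x in upstream M Φ j ∩ M.cell l, (pval (v l) x - u (x, s)) * pval ψ x := by
    rw [M.setIntegral_eq_sum hmeas hup hint, remapIntegral, ← Finset.sum_sub_distrib]
    refine Finset.sum_congr rfl fun l _ => ?_
    rw [← integral_sub]
    · simp only [sub_mul]
    · exact (((continuous_pval _).mul (continuous_pval _)).continuousOn.integrableOn_compact
        (M.isCompact_cell l)).mono_set inter_subset_right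
    · exact hint.mono_set inter_subset_left
  set b := 7200 * m with hb
  have hb0 : 0 ≤ b := by positivity
  have hterm : ∀ l, |∫ x in upstream M Φ j ∩ M.cell l, (pval (v l) x - u (x, s)) * pval ψ x|
      ≤ b * (|C₀| * Real.sqrt V * h ^ 4) := fun l => by
    have hi : IntegrableOn (fun x => pval (v l) x - u (x, s)) (M.cell l) :=
      (hdiffc l).integrableOn_compact (M.isCompact_cell l)
    have hE : eLpNorm (fun x => pval (v l) x - u (x, s)) 2 (volume.restrict (M.cell l))
        ≤ ENNReal.ofReal (|C₀| * h ^ 3) :=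
      (herr l).trans (ENNReal.ofReal_le_ofReal
        (mul_le_mul_of_nonneg_right (le_abs_self C₀) (by positivity)))
    have e1 := setIntegral_abs_le_of_eLpNorm_le hi.aestronglyMeasurable
      (M.isCompact_cell l).measure_lt_top.ne (by positivity) hE
    have e2 := M.sqrt_volume_real_cell_le l
    have e3 : |∫ x in upstream M Φ j ∩ M.cell l, (pval (v l) x - u (x, s)) * pval ψ x|
        ≤ ∫ x in upstream M Φ j ∩ M.cell l, b * |pval (v l) x - u (x, s)| := by
      refine norm_integral_le_of_norm_le (f := fun x => (pval (v l) x - u (x, s)) * pval ψ x)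
        (((hi.mono_set inter_subset_right).abs).const_mul b) ?_
      refine ae_restrict_of_forall_mem (hmeas.inter (M.measurableSet_cell l)) fun x hx => ?_
      rw [norm_mul, mul_comm]
      exact mul_le_mul_of_nonneg_right (hT.abs_fit_le hfit hx.1) (norm_nonneg _)
    rw [integral_const_mul] at e3
    have e4 : ∫ x in upstream M Φ j ∩ M.cell l, |pval (v l) x - u (x, s)|
        ≤ ∫ x in M.cell l, |pval (v l) x - u (x, s)| :=
      setIntegral_mono_set hi.abs (Filter.Eventually.of_forall fun x => abs_nonneg _)
        inter_subset_right.eventuallyLE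
    refine e3.trans (mul_le_mul_of_nonneg_left (e4.trans (e1.trans ?_)) hb0)
    calc |C₀| * h ^ 3 * Real.sqrt (volume.real (M.cell l)) ≤ |C₀| * h ^ 3 * (h * Real.sqrt V) := by
          gcongr
      _ = _ := by ring
  rw [hdiff]
  -- Only cells that meet the upstream element contribute; their number is bounded independently of
  -- h.
  set F := Finset.univ.filter fun l => (upstream M Φ j ∩ M.cell l).Nonempty with hF
  have hsum : ∑ l, ∫ x in upstream M Φ j ∩ M.cell l, (pval (v l) x - u (x, s)) * pval ψ x
      = ∑ l ∈ F, ∫ x in upstream M Φ j ∩ M.cell l, (pval (v l) x - u (x, s)) * pval ψ x := by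
    refine (Finset.sum_subset (Finset.subset_univ F) fun l _ hl => ?_).symm
    have : upstream M Φ j ∩ M.cell l = ∅ := by
      by_contra hne
      exact hl (by simp [hF, nonempty_iff_ne_empty.2 hne])
    rw [this, setIntegral_empty]
  have hcard : (F.card : ℝ) ≤ ((8 + 1) / σ) ^ 2 :=
    hM.card_le hσ (by norm_num) (stepBase A (M.vert j 0, t) (t - s)) F fun l hl => by
      obtain ⟨x, hx1, hx2⟩ := (Finset.mem_filter.1 hl).2
      exact ⟨x, hx2, hball hx1⟩
  rw [hsum]
  calc _ ≤ ∑ l ∈ F, |∫ x in upstream M Φ j ∩ M.cell l, (pval (v l) x - u (x, s)) * pval ψ x| :=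
        Finset.abs_sum_le_sum_abs _ _
    _ ≤ ∑ l ∈ F, b * (|C₀| * Real.sqrt V * h ^ 4) := Finset.sum_le_sum fun l _ => hterm l
    _ = F.card * (b * (|C₀| * Real.sqrt V * h ^ 4)) := by rw [Finset.sum_const, nsmul_eq_mul]
    _ ≤ ((8 + 1) / σ) ^ 2 * (b * (|C₀| * Real.sqrt V * h ^ 4)) := by gcongr
    _ = _ := by rw [hb]; ring

/-! ### The error estimate -/

lemma isQuad_affine (r : ℝ) (φ : Plane →L[ℝ] ℝ) (x₀ : Plane) :
    IsQuad fun x => r + φ (x - x₀) := by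
  refine ⟨![r - φ x₀, φ (EuclideanSpace.single 0 1), φ (EuclideanSpace.single 1 1), 0, 0, 0],
    fun x => ?_⟩
  have : φ x = x 0 * φ (EuclideanSpace.single 0 1) + x 1 * φ (EuclideanSpace.single 1 1) := by
    conv_lhs => rw [plane_eq_sum x, map_add, map_smul, map_smul, smul_eq_mul, smul_eq_mul]
  simp [map_sub, this]
  ring

/-- The square root of the area of the cell supplies one power of h: a pointwise error O(h²) becomes
O(h³) in L². -/
lemma cellError_le {J : ℕ} (M : TriMesh J) (j : Fin J) {p : Poly 2} {f : Plane → ℝ} {B : ℝ}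
    (hB : 0 ≤ B) (h : ∀ x ∈ M.cell j, |pval p x - f x| ≤ B) :
    cellError M j p f
      ≤ ENNReal.ofReal (B * (M.size * Real.sqrt (volume.real (Metric.ball (0 : Plane) 1)))) := by
  have h1 := eLpNorm_le_of_ae_bound (p := 2) (μ := volume.restrict (M.cell j))
    (f := fun x => pval p x - f x) (C := B) (ae_restrict_of_forall_mem (M.measurableSet_cell j) h)
  refine h1.trans ?_
  rw [mul_comm, ENNReal.ofReal_mul hB]
  refine mul_le_mul_right ?_ _
  rw [Measure.restrict_apply_univ, ← ofReal_measureReal (M.isCompact_cell j).measure_lt_top.ne,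
    ENNReal.ofReal_rpow_of_nonneg measureReal_nonneg (by norm_num)]
  refine ENNReal.ofReal_le_ofReal ?_
  refine le_trans (le_of_eq ?_) (M.sqrt_volume_real_cell_le j)
  rw [Real.sqrt_eq_rpow]
  norm_num

/-- If the moments of `p` and of the exact solution agree up to second order, then so do `p` and
the exact solution. -/
lemma exists_pointwise_bound {Ω : Set Plane} {T C : ℝ} {A : Plane × ℝ → Plane} {u : Plane × ℝ → ℝ}
    (hD : DataBounds (closure Ω ×ˢ Icc 0 T) A u C) {σ : ℝ} (hσ : 0 < σ) {C₁ : ℝ} (hC₁ : 0 ≤ C₁) :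
    ∃ C', 0 ≤ C' ∧ ∀ (J : ℕ) (M : TriMesh J) (t : ℝ) (j : Fin J) (p : Poly 2),
      M.region ⊆ closure Ω → M.IsQuasiUniform σ → 0 ≤ t → t ≤ T →
      (∀ Ψ : Poly 2, |(∫ x in M.cell j, pval p x * pval Ψ x) - ∫ x in M.cell j, u (x, t) * pval Ψ x|
        ≤ C₁ * M.size ^ 2 * (|(M.cellLin j).det|
          * nodalNorm fun ξ => pval Ψ (M.vert j 0 + M.cellLin j ξ))) →
      ∀ x ∈ M.cell j, |pval p x - u (x, t)| ≤ C' * M.size ^ 2 := by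
  have hC0 : 0 ≤ C := zero_le_one.trans hD.one_le
  obtain ⟨c, hc, hcoer⟩ := exists_coercivity
  set C₂ := C₁ + C * 2400 * volume.real refTri with hC₂
  have hC₂0 : 0 ≤ C₂ := by positivity
  refine ⟨2400 * (C₂ / c) + C, by positivity, ?_⟩
  intro J M t j p hreg hM ht0 htT hmom
  set h := M.size with hh
  set x₀ := M.vert j 0 with hx₀
  set L := M.cellLin j with hL
  have hpos : 0 < h := M.size_pos j
  have hmem : ∀ {x}, x ∈ M.cell j → (x, t) ∈ closure Ω ×ˢ Icc 0 T := fun hx =>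
    ⟨hreg (mem_iUnion.2 ⟨j, hx⟩), ht0, htT⟩
  have hp₀ := hmem (M.vert_mem_cell j 0)
  have hinj := hM.cellLin_injective hσ j
  have hvol := volume_real_cell M j hinj
  have hdet : 0 < |L.det| := by
    have h1 := hM.le_volume_real_cell hσ j
    have h2 : 0 < (σ * h) ^ 2 * volume.real (Metric.ball (0 : Plane) 1) :=
      mul_pos (by positivity) volume_real_unitBall_pos
    rw [hvol] at h1
    exact pos_of_mul_pos_left (h2.trans_le h1) measureReal_nonneg
  -- The linear Taylor polynomial suffices, since only O(h²) is needed pointwise.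
  obtain ⟨Q, hQ⟩ := (isQuad_affine (u (x₀, t))
    ((fderiv ℝ u (x₀, t)).comp (ContinuousLinearMap.inl ℝ Plane ℝ)) x₀).exists_pval_eq
  have hQu : ∀ x ∈ M.cell j, |u (x, t) - pval Q x| ≤ C * h ^ 2 := fun x hx => by
    rw [hQ]
    exact hD.abs_sol_sub_linear_le hp₀ (hmem hx) (M.norm_sub_le_size j hx (M.vert_mem_cell j 0))
  -- Testing with the difference itself bounds its squared L² norm by a term linear in its nodal
  -- norm m; coercivity then bounds m.
  set Ψ : Poly 2 := p - Q with hΨ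
  set Ψ' : Plane → ℝ := fun ξ => pval Ψ (x₀ + L ξ) with hΨ'
  have hΨq : IsQuad Ψ' := (isQuad_pval Ψ).comp_affine _ _
  set m := nodalNorm Ψ' with hm
  have hm0 : 0 ≤ m := nodalNorm_nonneg _
  have hΨle : ∀ x ∈ M.cell j, |pval Ψ x| ≤ 2400 * m := fun x hx => by
    rw [M.cell_eq_image] at hx
    obtain ⟨ξ, hξ, rfl⟩ := hx
    exact hΨq.abs_le ((norm_le_one_of_mem_refTri hξ).trans (by norm_num))
  have hucont : ContinuousOn (fun x => u (x, t)) (M.cell j) :=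
    hD.cont.comp (f := fun x : Plane => (x, t)) (by fun_prop) fun x hx => hmem hx
  have hiu : IntegrableOn (fun x => u (x, t) * pval Ψ x) (M.cell j) :=
    (hucont.mul (continuous_pval Ψ).continuousOn).integrableOn_compact (M.isCompact_cell j)
  have hip : ∀ q : Poly 2, IntegrableOn (fun x => pval q x * pval Ψ x) (M.cell j) := fun q =>
    ((continuous_pval q).mul (continuous_pval Ψ)).continuousOn.integrableOn_compact
      (M.isCompact_cell j)
  have hsplit : ∫ x in M.cell j, pval Ψ x * pval Ψ x
      = ((∫ x in M.cell j, pval p x * pval Ψ x) - ∫ x in M.cell j, u (x, t) * pval Ψ x)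
        + ∫ x in M.cell j, (u (x, t) - pval Q x) * pval Ψ x := by
    have e1 : ∫ x in M.cell j, (u (x, t) - pval Q x) * pval Ψ x
        = (∫ x in M.cell j, u (x, t) * pval Ψ x) - ∫ x in M.cell j, pval Q x * pval Ψ x := by
      rw [← integral_sub hiu (hip Q)]
      simp only [sub_mul]
    have e2 : ∫ x in M.cell j, pval Ψ x * pval Ψ x
        = (∫ x in M.cell j, pval p x * pval Ψ x) - ∫ x in M.cell j, pval Q x * pval Ψ x := by
      rw [← integral_sub (hip p) (hip Q)]
      refine integral_congr_ae (Filter.Eventually.of_forall fun x => ?_)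
      simp only [hΨ, pval_sub, sub_mul]
    rw [e1, e2]
    ring
  have h1 : |∫ x in M.cell j, (u (x, t) - pval Q x) * pval Ψ x|
      ≤ C * h ^ 2 * (2400 * m) * (|L.det| * volume.real refTri) := by
    rw [← hvol, ← Real.norm_eq_abs]
    refine norm_setIntegral_le_of_norm_le_const (M.isCompact_cell j).measure_lt_top fun x hx => ?_
    rw [norm_mul]
    exact mul_le_mul (hQu x hx) (hΨle x hx) (norm_nonneg _) (by positivity)
  have h2 := hmom Ψ
  have h3 : ∫ x in M.cell j, pval Ψ x * pval Ψ x = |L.det| * ∫ ξ in refTri, Ψ' ξ * Ψ' ξ :=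
    setIntegral_cell M j hinj fun x => pval Ψ x * pval Ψ x
  have h4 := hcoer Ψ' hΨq
  have h5 : |L.det| * (c * m ^ 2) ≤ |L.det| * (C₂ * h ^ 2 * m) := by
    calc |L.det| * (c * m ^ 2) ≤ ∫ x in M.cell j, pval Ψ x * pval Ψ x := by
          rw [h3]
          exact mul_le_mul_of_nonneg_left h4 hdet.le
      _ ≤ C₁ * h ^ 2 * (|L.det| * m) + C * h ^ 2 * (2400 * m) * (|L.det| * volume.real refTri) := by
          rw [hsplit]
          exact add_le_add ((le_abs_self _).trans h2) ((le_abs_self _).trans h1)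
      _ = |L.det| * (C₂ * h ^ 2 * m) := by rw [hC₂]; ring
  have h6 : c * m ^ 2 ≤ C₂ * h ^ 2 * m := le_of_mul_le_mul_left h5 hdet
  have h7 : m ≤ C₂ / c * h ^ 2 := by
    rcases hm0.eq_or_lt with h0 | h0
    · rw [← h0]; positivity
    · have : c * m ≤ C₂ * h ^ 2 := le_of_mul_le_mul_right (by linarith) h0
      rw [div_mul_eq_mul_div, le_div_iff₀ hc]
      linarith
  intro x hx
  have e1 : pval p x - u (x, t) = pval Ψ x - (u (x, t) - pval Q x) := by
    rw [hΨ, pval_sub]; ring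
  rw [e1]
  refine (abs_sub _ _).trans ?_
  linarith [hΨle x hx, hQu x hx]

end SLDG

end

/-! ### Choice of the constants and assembly of the estimates -/

theorem theorem4p5 (Ω : Set SLDG.Plane) (hΩ : IsOpen Ω) (hΩb : Bornology.IsBounded Ω) (T : ℝ)
    (a b u : SLDG.Plane × ℝ → ℝ)
    (ha : SLDG.SmoothOnCylinder Ω T a) (hb : SLDG.SmoothOnCylinder Ω T b)
    (hu : SLDG.SmoothOnCylinder Ω T u) (hpde : SLDG.SolvesTransport Ω T a b u)
    (σ c₁ c₂ κ C₀ : ℝ) (hσ : 0 < σ) (hc₁ : 0 < c₁) :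
    ∃ C h₀ : ℝ, 0 < C ∧ 0 < h₀ ∧
      ∀ (J : ℕ) (M : SLDG.TriMesh J) (tₙ Δt : ℝ) (Φ : SLDG.Plane → SLDG.Plane)
        (uₙ : M.DGSpace 2),
        M.region ⊆ closure Ω → M.IsQuasiUniform σ → M.size ≤ h₀ →
        c₁ * M.size ≤ Δt → Δt ≤ c₂ * M.size → 0 ≤ tₙ → tₙ + Δt ≤ T →
        SLDG.TracingAccurate M Ω a b tₙ (tₙ + Δt) κ Φ →
        (∀ l, SLDG.cellError M l (uₙ l) (fun x => u (x, tₙ)) ≤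
          ENNReal.ofReal (C₀ * M.size ^ 3)) →
        ∃ uNew : M.DGSpace 2, ∀ j, SLDG.UpstreamInside M Ω a b tₙ (tₙ + Δt) Φ j →
          (∀ p : SLDG.Poly 2, SLDG.IsUpdate M Φ uₙ j p ↔ p = uNew j) ∧
          SLDG.cellError M j (uNew j) (fun x => u (x, tₙ + Δt)) ≤
            ENNReal.ofReal (C * M.size ^ 3) := by
  obtain ⟨C, hD⟩ := SLDG.exists_dataBounds hΩb ha hb hu hpde
  have hC0 : 0 ≤ C := zero_le_one.trans hD.one_le
  -- The constant c₂ comes without a sign, while the estimates need a nonnegative bound for Δ / h.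
  set c := max c₂ 0 with hc
  have hc0 : 0 ≤ c := le_max_right _ _
  set e := 4 / σ * (C * ((C + 1) * c + 1) * c ^ 2 + c * C + |κ| * c ^ 3) with he
  have he0 : 0 ≤ e := by positivity
  set V := volume.real (Metric.ball (0 : SLDG.Plane) 1) with hV
  have hV0 : 0 < V := SLDG.volume_real_unitBall_pos
  obtain ⟨C₁, hC₁, hcons⟩ := SLDG.exists_consistency hD hc0 he0
  obtain ⟨C₂, hC₂, hremap⟩ := SLDG.exists_remap_bound hD hσ c C₀
  obtain ⟨C₃, hC₃, hpw⟩ := SLDG.exists_pointwise_bound hD hσ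
    (C₁ := C₂ * (volume.real SLDG.refTri / (σ ^ 2 * V)) + C₁) (by positivity)
  -- The three summands of the denominator ensure h ≤ 1, invertibility of the affine step, and small
  -- node displacements. The added 1 only makes the error constant positive.
  refine ⟨C₃ * Real.sqrt V + 1, 1 / (1 + 2 * (c * C) + 2400 * e), by positivity, by positivity, ?_⟩
  intro J M s Δ Φ v hreg hM hh₀ hΔ₁ hΔ₂ hs ht htr herr
  have key : ∀ j, ∃ p : SLDG.Poly 2, SLDG.UpstreamInside M Ω a b s (s + Δ) Φ j →
      (∀ p', SLDG.IsUpdate M Φ v j p' ↔ p' = p) ∧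
      SLDG.cellError M j p (fun x => u (x, s + Δ)) ≤
        ENNReal.ofReal ((C₃ * Real.sqrt V + 1) * M.size ^ 3) := by
    intro j
    by_cases hin : SLDG.UpstreamInside M Ω a b s (s + Δ) Φ j
    swap
    -- Nothing is claimed on cells whose upstream data leave the domain, so any value will do.
    · exact ⟨0, fun h => absurd h hin⟩
    have hpos := M.size_pos j
    have hΔ0 : 0 ≤ Δ := (by positivity : 0 ≤ c₁ * M.size).trans hΔ₁
    have hst : s ≤ s + Δ := by linarith
    have hΔc : s + Δ - s ≤ c * M.size := by
      rw [add_sub_cancel_left]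
      exact hΔ₂.trans (mul_le_mul_of_nonneg_right (le_max_left _ _) hpos.le)
    rw [le_div_iff₀ (by positivity)] at hh₀
    have hcC : 0 ≤ c * C * M.size := by positivity
    have heh : 0 ≤ e * M.size := by positivity
    have hh1 : M.size ≤ 1 := by nlinarith
    have hΔC : 2 * (c * C) * M.size ≤ 1 := by nlinarith
    have hε : 2400 * (e * M.size ^ 2) ≤ 1 := by
      have : e * M.size ^ 2 ≤ e * M.size := mul_le_mul_of_nonneg_left (by nlinarith) he0
      nlinarith
    obtain ⟨ρ, hT⟩ := SLDG.exists_traced hD hσ hc0 hreg hM hs hst ht hΔc hΔC htr hin hε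
    have hinj := hM.cellLin_injective hσ j
    have huni : ∀ ψ : SLDG.Poly 2, (∀ q, SLDG.pval ψ (Φ (M.node j q)) = 0) → ψ = 0 :=
      fun ψ h => hT.unisolvent h
    obtain ⟨p, hp⟩ := SLDG.exists_update Φ j hσ hM huni v
    obtain ⟨S, hS⟩ := SLDG.exists_fit_linear M Φ j huni
    refine ⟨p, fun _ => ⟨hp, ?_⟩⟩
    have hbound := hpw J M (s + Δ) j p hreg hM (hs.trans hst) ht fun Ψ => by
      have hfit : SLDG.IsLeastSquaresFit M Φ j Ψ (S Ψ) := (hS Ψ _).2 rfl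
      have h1 := hcons J M s (s + Δ) Φ j ρ hreg hs hst ht hΔc hh1 hΔC hinj hT hin.2 Ψ _ hfit
      have h2 := hremap J M s (s + Δ) _ Φ j ρ v hreg hM hs hst ht hΔc hΔC hT hin.2 herr Ψ _ hfit
      rw [(hp p).2 rfl Ψ _ hfit]
      set m := SLDG.nodalNorm fun ξ => SLDG.pval Ψ (M.vert j 0 + M.cellLin j ξ) with hm
      have hm0 : 0 ≤ m := SLDG.nodalNorm_nonneg _
      have hvol := hM.le_volume_real_cell hσ j
      rw [SLDG.volume_real_cell M j hinj] at hvol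
      -- The inscribed disc bounds the area of the cell from below, which turns the inherited error
      -- of order h⁴ into h² relative to |det L|.
      have h3 : M.size ^ 2 ≤ |(M.cellLin j).det| * (volume.real SLDG.refTri / (σ ^ 2 * V)) := by
        rw [← mul_div_assoc, le_div_iff₀ (by positivity)]
        linarith
      have h4 : C₂ * M.size ^ 4 * m ≤ C₂ * M.size ^ 2
          * (|(M.cellLin j).det| * (volume.real SLDG.refTri / (σ ^ 2 * V))) * m := by
        rw [show C₂ * M.size ^ 4 * m = C₂ * M.size ^ 2 * M.size ^ 2 * m by ring]
        gcongr
      -- The intermediate quantity is the exact old solution integrated over the upstream element,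
      -- which separates the inherited error from the consistency error.
      refine (abs_sub_le _ _ _).trans ((add_le_add h2 h1).trans ?_)
      linarith
    refine (SLDG.cellError_le M j (by positivity) hbound).trans (ENNReal.ofReal_le_ofReal ?_)
    have : 0 ≤ M.size ^ 3 := by positivity
    nlinarith
  choose uNew hNew using key
  exact ⟨uNew, hNew⟩
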